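/- Let $\bar Y=(\bar Y_s)_{s\in\mathbb R}$ be a double-sided real Lévy process on a probability space (i.e. $\bar Y_0=0$ a.s., stationary and independent increments, a.s. càdlàg paths) with $\mathbb E[\ln^+|\bar Y_1|]<\infty$, let $\rho$ be the Lévy measure of $\bar Y_1$, and let $H>0$. Let $X=(X_t)_{t\ge 0}$ be the $H$-selfsimilar Sato process given, for every $t\ge 0$, a.s. by $$X_t=\int_{\ln(t^{-H})}^{\infty}e^{-s}\,d\bar Y_s\qquad (X_0=0),$$ where the integral over $(a,b]$ is evaluated pathwise by parts, $\int_a^b e^{-s}\,d\bar Y_s=e^{-b}\bar Y_b-e^{-a}\bar Y_a+\int_a^b e^{-s}\bar Y_s\,ds$, and $\int_a^\infty=\lim_{b\to\infty}\int_a^b$; these limits exist almost surely. A measure $\nu$ on $\mathbb R^{[0,\infty)}$ with its cylindrical $\sigma$-algebra is called the Lévy measure of $X$ if (i) for all finite $\{t_1,\dots,t_n\}\subset[0,\infty)$ the projection of $\nu$ onto $\mathbb R^{\{t_1,\dots,t_n\}}$, restricted to the complement of the origin, is the Lévy measure of the random vector $(X_{t_1},\dots,X_{t_n})$, and (ii)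 $\nu(A)=\sup\{\nu(B): B\text{ measurable},\ B\subseteq A\setminus\{0\}\}$ for every measurable $A$. Then $X$ has exactly one Lévy measure $\nu$, and for every measurable $F:\mathbb R^{[0,\infty)}\to[0,\infty]$ $$\int F\,d\nu=\int_{\mathbb R}\int_{\mathbb R}F\big(x e^{-s}\mathbf 1_{[e^{-s/H},\infty)}\big)\,\rho(dx)\,ds .$$ That is, $\nu$ is the image of $\mathrm{Leb}\otimes\rho$ under the map $(s,x)\mapsto x f_{\cdot}(s)$ from $\mathbb R^2$ to $\mathbb R^{[0,\infty)}$, where $f_t(s)=e^{-s}\mathbf 1_{[e^{-s/H},\infty)}(t)$. -/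

import Mathlib

open MeasureTheory ProbabilityTheory Filter Topology
open scoped ENNReal NNReal

noncomputable section

/-- `IsLevyMeasure μ ρ`: the measure `ρ` is the Lévy measure of the (infinitely divisible)
probability law `μ` on a Euclidean space, i.e. `ρ` does not charge the origin, integrates
`1 ∧ ‖x‖²`, and the characteristic function of `μ` has the Lévy–Khintchine form with some drift
`b`, some Gaussian covariance operator `S` and the measure `ρ`. -/
def IsLevyMeasure {E : Type*} [NormedAddCommGroup E] [InnerProductSpace ℝ E]
    [FiniteDimensional ℝ E] [MeasurableSpace E] [BorelSpace E] (μ ρ : Measure E) : Prop :=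
  ρ {0} = 0 ∧
  ∫⁻ x, ENNReal.ofReal (min 1 (‖x‖ ^ 2)) ∂ρ < ∞ ∧
  ∃ (b : E) (S : E →L[ℝ] E), S.IsPositive ∧ ∀ u : E,
    charFun μ u = Complex.exp
      ((inner ℝ b u : ℝ) * Complex.I - ((inner ℝ (S u) u : ℝ) : ℂ) / 2
        + ∫ x, (Complex.exp ((inner ℝ x u : ℝ) * Complex.I) - 1
            - if ‖x‖ ≤ 1 then (inner ℝ x u : ℝ) * Complex.I else 0) ∂ρ)

/-- `IsProcessLevyMeasure P ξ ν`: the measure `ν` on the path space `T → ℝ`, with its cylindrical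
σ-algebra, is the Lévy measure of the (infinitely divisible) process `ξ`: its finite-dimensional
projections are, off the origin, the Lévy measures of the finite-dimensional marginals of `ξ`, and
`ν A` is the inner `ν`-measure of `A \ {0}` for every measurable `A`. -/
def IsProcessLevyMeasure {Ω T : Type*} [MeasurableSpace Ω] (P : Measure Ω)
    (ξ : T → Ω → ℝ) (ν : Measure (T → ℝ)) : Prop :=
  (∀ I : Finset T,
    IsLevyMeasure (P.map fun ω ↦ (WithLp.toLp 2 fun i : I ↦ ξ i ω : EuclideanSpace ℝ I))
      ((ν.map fun f ↦ (WithLp.toLp 2 fun i : I ↦ f i : EuclideanSpace ℝ I)).restrict {0}ᶜ)) ∧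
  ∀ A : Set (T → ℝ), MeasurableSet A →
    ν A = ⨆ (B : Set (T → ℝ)) (_ : MeasurableSet B) (_ : B ⊆ A \ {0}), ν B

/-- A double-sided real Lévy process. -/
structure IsTwoSidedLevyProcess {Ω : Type*} [MeasurableSpace Ω] (P : Measure Ω)
    (Y : ℝ → Ω → ℝ) : Prop where
  measurable : ∀ s, Measurable (Y s)
  zero : ∀ᵐ ω ∂P, Y 0 ω = 0
  indep : HasIndepIncrements Y P
  stationary : ∀ r s h : ℝ, IdentDistrib (fun ω ↦ Y (s + h) ω - Y (r + h) ω)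
    (fun ω ↦ Y s ω - Y r ω) P P
  cadlag : ∀ᵐ ω ∂P, ∀ s : ℝ, ContinuousWithinAt (fun r ↦ Y r ω) (Set.Ici s) s ∧
    ∃ l : ℝ, Tendsto (fun r ↦ Y r ω) (𝓝[<] s) (𝓝 l)

/-- The pathwise integral `∫_{(a,b]} g(s) dy(s)` of a smooth function `g` against a càdlàg path
`y`, evaluated by parts. -/
def pathIntegral (g y : ℝ → ℝ) (a b : ℝ) : ℝ :=
  g b * y b - g a * y a - ∫ s in a..b, y s * deriv g s

/-- The process `X_t = ∫_{ln (t^{-H})}^∞ e^{-s} dY_s`, `t ≥ 0`, as an improper pathwise integral.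
For `t = 0` the lower limit is `+∞` and the integral is `0`. -/
def satoProcess {Ω : Type*} (Y : ℝ → Ω → ℝ) (H : ℝ) (t : ℝ≥0) (ω : Ω) : ℝ :=
  if t = 0 then 0
  else limUnder atTop fun b : ℝ ↦
    pathIntegral (fun s ↦ Real.exp (-s)) (fun s ↦ Y s ω) (Real.log ((t : ℝ) ^ (-H))) b

/-- The deterministic path `t ↦ x e^{-s} 1_{[e^{-s/H}, ∞)}(t)`, `t ≥ 0`. -/
def jumpPath (H s x : ℝ) (t : ℝ≥0) : ℝ :=
  x * Real.exp (-s) * (Set.Ici (Real.exp (-s / H))).indicator 1 (t : ℝ)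

end

/-!
The increments of `Y` have characteristic function `exp ((t - s) ψ)`, with `ψ` the Lévy–Khintchine
exponent of `Y₁`, so Riemann sums give `exp (∫ ψ (g s) ds)` for the integral of a smooth `g`
against `Y`. Ottaviani's inequality, the logarithmic moment and Borel–Cantelli show
`Y_s = O(e^{θ s})` for every `θ > 0`, hence the integrals defining `X` converge.

The characteristic function of the limit does not vanish near `0`. Averaging `1 - cos` over this
neighbourhood bounds `∬ min(1, x² f_t(s)²) ρ(dx) ds`, with `f_t(s) = e^{-s} 1_{[e^{-s/H}, ∞)}(t)`.
The exponent of `(X_t)_{t ∈ I}`, namely `u ↦ ∫ ψ (∑ t ∈ I, u_t f_t(s)) ds`, is then itself of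
Lévy–Khintchine form, the Lévy measure being the image of `ds ⊗ ρ` off the origin: only the linear
truncation terms have to be compared, and `f_t(s) ∈ {0, e^{-s}}` makes their difference integrable.

For uniqueness, minus a second difference of the exponent is the characteristic function of a finite
measure with density `2 - 2 cos ⟨x, w⟩` with respect to the Lévy measure off the origin, so the law
determines the Lévy measure of a vector. On path space, a measurable set without the zero path
depends on countably many coordinates and is therefore covered by the sets `{f | ε < |f t|}`, of
finite measure, on which the finite-dimensional projections determine the measure.
-/

section LevyKhintchineExponent

lemma sigmaFinite_of_lintegral_ne_top {α : Type*} [MeasurableSpace α] {μ : Measure α}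
    {f : α → ℝ≥0∞} (hf : Measurable f) (hfin : ∫⁻ x, f x ∂μ ≠ ∞) (hpos : ∀ᵐ x ∂μ, f x ≠ 0) :
    SigmaFinite μ := by
  have : IsFiniteMeasure (μ.withDensity f) := isFiniteMeasure_withDensity hfin
  have hf_top : ∀ᵐ x ∂μ, f x ≠ ∞ := (ae_lt_top hf hfin).mono fun _ hx ↦ hx.ne
  rw [← withDensity_inv_same hf hpos hf_top]
  refine SigmaFinite.withDensity_of_ne_top ((ae_withDensity_iff hf).2 ?_)
  exact Eventually.of_forall fun x hx ↦ ENNReal.inv_ne_top.2 hx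

lemma norm_exp_mul_I_sub_one_le_two (y : ℝ) : ‖Complex.exp (y * Complex.I) - 1‖ ≤ 2 := by
  refine (norm_sub_le _ _).trans_eq ?_
  rw [Complex.norm_exp_ofReal_mul_I, norm_one, one_add_one_eq_two]

lemma norm_exp_mul_I_sub_one_sub_le (y : ℝ) :
    ‖Complex.exp (y * Complex.I) - 1 - y * Complex.I‖ ≤ 3 * y ^ 2 := by
  have hn : ‖(y : ℂ) * Complex.I‖ = |y| := by simp
  rcases le_or_gt |y| 1 with hy | hy
  · have hexp := Complex.norm_exp_sub_one_sub_id_le (x := y * Complex.I) (by rwa [hn])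
    rw [hn, sq_abs] at hexp
    linarith [sq_nonneg y]
  · refine (norm_sub_le _ _).trans ?_
    rw [hn]
    nlinarith [norm_exp_mul_I_sub_one_le_two y, sq_abs y]

variable {E : Type*} [NormedAddCommGroup E] [InnerProductSpace ℝ E]

/-- The integrand of the Lévy–Khintchine formula: the exponential `e^{i⟨x, u⟩}`, compensated by
`1 + i⟨x, u⟩ 1_{‖x‖ ≤ 1}`. -/
noncomputable def levyKernel (x u : E) : ℂ :=
  Complex.exp ((inner ℝ x u : ℝ) * Complex.I) - 1
    - if ‖x‖ ≤ 1 then (inner ℝ x u : ℝ) * Complex.I else 0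

@[simp] lemma levyKernel_zero_right (x : E) : levyKernel x 0 = 0 := by
  simp [levyKernel]

lemma norm_levyKernel_le (x u : E) :
    ‖levyKernel x u‖ ≤ (2 + 3 * ‖u‖ ^ 2) * min 1 (‖x‖ ^ 2) := by
  unfold levyKernel
  split_ifs with hx
  · have hinner : inner ℝ x u ^ 2 ≤ ‖x‖ ^ 2 * ‖u‖ ^ 2 := by
      rw [← mul_pow, ← sq_abs]
      exact pow_le_pow_left₀ (abs_nonneg _) (abs_real_inner_le_norm x u) 2
    rw [min_eq_right (pow_le_one₀ (norm_nonneg x) hx)]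
    refine (norm_exp_mul_I_sub_one_sub_le _).trans ?_
    linarith [sq_nonneg ‖x‖]
  · rw [min_eq_left (one_le_pow₀ (not_le.1 hx).le), sub_zero]
    refine (norm_exp_mul_I_sub_one_le_two _).trans ?_
    linarith [sq_nonneg ‖u‖]

lemma continuous_levyKernel_right (x : E) : Continuous (levyKernel x) := by
  unfold levyKernel
  split_ifs <;> fun_prop

lemma levyKernel_add_add_levyKernel_sub (x u w : E) :
    levyKernel x (u + w) + levyKernel x (u - w) - 2 * levyKernel x u
      = -(((2 - 2 * Real.cos (inner ℝ x w) : ℝ) : ℂ) *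
        Complex.exp ((inner ℝ x u : ℝ) * Complex.I)) := by
  have hcancel : levyKernel x (u + w) + levyKernel x (u - w) - 2 * levyKernel x u
      = Complex.exp ((inner ℝ x u : ℝ) * Complex.I + (inner ℝ x w : ℝ) * Complex.I)
        + Complex.exp ((inner ℝ x u : ℝ) * Complex.I + -((inner ℝ x w : ℝ) * Complex.I))
        - 2 * Complex.exp ((inner ℝ x u : ℝ) * Complex.I) := by
    unfold levyKernel
    rw [inner_add_right, inner_sub_right]
    split_ifs <;> push_cast <;> simp only [sub_eq_add_neg, add_mul, neg_mul] <;> ring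
  rw [hcancel, Complex.exp_add, Complex.exp_add]
  push_cast
  rw [Complex.cos, ← neg_mul]
  ring

variable [MeasurableSpace E]

/-- The Lévy–Khintchine exponent, i.e. the continuous logarithm of the characteristic function, of
the infinitely divisible law with drift `b`, Gaussian covariance `S` and Lévy measure `ρ`. -/
noncomputable def levyExponent (b : E) (S : E →L[ℝ] E) (ρ : Measure E) (u : E) : ℂ :=
  (inner ℝ b u : ℝ) * Complex.I - ((inner ℝ (S u) u : ℝ) : ℂ) / 2 + ∫ x, levyKernel x u ∂ρ

@[simp] lemma levyExponent_zero (b : E) (S : E →L[ℝ] E) (ρ : Measure E) :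
    levyExponent b S ρ 0 = 0 := by
  simp [levyExponent]

variable [BorelSpace E] [SecondCountableTopology E] {ρ : Measure E}

@[fun_prop]
lemma measurable_levyKernel {α : Type*} [MeasurableSpace α]
    {f g : α → E} (hf : Measurable f) (hg : Measurable g) :
    Measurable fun a ↦ levyKernel (f a) (g a) := by
  unfold levyKernel
  refine Measurable.sub (by fun_prop) (Measurable.ite ?_ (by fun_prop) measurable_const)
  exact measurableSet_le (by fun_prop) measurable_const

lemma integrable_levyKernel (hρ : Integrable (fun x ↦ min 1 (‖x‖ ^ 2)) ρ) (u : E) :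
    Integrable (fun x ↦ levyKernel x u) ρ :=
  (hρ.const_mul _).mono'
    (by fun_prop : Measurable fun x : E ↦ levyKernel x u).aestronglyMeasurable
    (Eventually.of_forall fun x ↦ norm_levyKernel_le x u)

lemma continuous_levyExponent (hρ : Integrable (fun x ↦ min 1 (‖x‖ ^ 2)) ρ) (b : E)
    (S : E →L[ℝ] E) : Continuous (levyExponent b S ρ) := by
  unfold levyExponent
  refine Continuous.add (by fun_prop) (continuous_iff_continuousAt.2 fun u₀ ↦ ?_)
  refine continuousAt_of_dominated
    (bound := fun x ↦ (2 + 3 * (‖u₀‖ + 1) ^ 2) * min 1 (‖x‖ ^ 2)) ?_ ?_ (hρ.const_mul _) ?_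
  · exact Eventually.of_forall fun u ↦
      (by fun_prop : Measurable fun x : E ↦ levyKernel x u).aestronglyMeasurable
  · filter_upwards [Metric.ball_mem_nhds u₀ one_pos] with u hu
    refine Eventually.of_forall fun x ↦ (norm_levyKernel_le x u).trans ?_
    have hu' : ‖u‖ ≤ ‖u₀‖ + 1 :=
      (norm_le_norm_add_norm_sub' u u₀).trans (by gcongr; exact (mem_ball_iff_norm.1 hu).le)
    gcongr
  · exact Eventually.of_forall fun x ↦ (continuous_levyKernel_right x).continuousAt

lemma integrable_two_sub_two_mul_cos (hρ : Integrable (fun x ↦ min 1 (‖x‖ ^ 2)) ρ) (w : E) :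
    Integrable (fun x ↦ 2 - 2 * Real.cos (inner ℝ x w)) ρ := by
  have hdiff := ((integrable_levyKernel hρ (0 + w)).add (integrable_levyKernel hρ (0 - w))).sub
    ((integrable_levyKernel hρ 0).const_mul 2)
  refine hdiff.neg.re.congr (Eventually.of_forall fun x ↦ ?_)
  have hx := levyKernel_add_add_levyKernel_sub x 0 w
  rw [inner_zero_right, Complex.ofReal_zero, zero_mul, Complex.exp_zero, mul_one] at hx
  simp only [Pi.neg_apply, Pi.sub_apply, Pi.add_apply, hx, neg_neg]
  exact Complex.ofReal_re _

lemma levyExponent_add_add_levyExponent_sub (hρ : Integrable (fun x ↦ min 1 (‖x‖ ^ 2)) ρ)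
    (b : E) (S : E →L[ℝ] E) (u w : E) :
    levyExponent b S ρ (u + w) + levyExponent b S ρ (u - w) - 2 * levyExponent b S ρ u
      = -(∫ x, ((2 - 2 * Real.cos (inner ℝ x w) : ℝ) : ℂ) *
        Complex.exp ((inner ℝ x u : ℝ) * Complex.I) ∂ρ + (inner ℝ (S w) w : ℝ)) := by
  have hkernel : ∫ x, levyKernel x (u + w) ∂ρ + ∫ x, levyKernel x (u - w) ∂ρ
      - 2 * ∫ x, levyKernel x u ∂ρ
      = -∫ x, ((2 - 2 * Real.cos (inner ℝ x w) : ℝ) : ℂ) *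
        Complex.exp ((inner ℝ x u : ℝ) * Complex.I) ∂ρ := by
    have hint := integrable_levyKernel hρ
    rw [← integral_add (hint _) (hint _), ← integral_const_mul,
      ← integral_sub (by exact (hint _).add (hint _)) ((hint _).const_mul 2), ← integral_neg]
    exact integral_congr_ae (Eventually.of_forall fun x ↦ levyKernel_add_add_levyKernel_sub x u w)
  unfold levyExponent
  rw [neg_add, ← hkernel]
  simp only [map_add, map_sub, inner_add_left, inner_add_right, inner_sub_left, inner_sub_right]
  push_cast
  ring

end LevyKhintchineExponent

section CharExponent

/-- `ψ` is the characteristic exponent of the law `μ`: the continuous logarithm of its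
characteristic function, normalised to vanish at `0`. -/
structure IsCharExponent {E : Type*} [NormedAddCommGroup E] [InnerProductSpace ℝ E]
    [MeasurableSpace E] (μ : Measure E) (ψ : E → ℂ) : Prop where
  continuous : Continuous ψ
  map_zero : ψ 0 = 0
  charFun_eq_exp : ∀ u, charFun μ u = Complex.exp (ψ u)

lemma IsCharExponent.unique {E : Type*} [NormedAddCommGroup E] [InnerProductSpace ℝ E]
    [MeasurableSpace E] {μ : Measure E} {ψ₁ ψ₂ : E → ℂ} (h₁ : IsCharExponent μ ψ₁)
    (h₂ : IsCharExponent μ ψ₂) : ψ₁ = ψ₂ := by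
  refine Complex.isCoveringMap_exp.eq_of_comp_eq h₁.continuous h₂.continuous
    (funext fun u ↦ Subtype.ext ?_) 0 (h₁.map_zero.trans h₂.map_zero.symm)
  exact (h₁.charFun_eq_exp u).symm.trans (h₂.charFun_eq_exp u)

end CharExponent

lemma iUnion_cos_inner_denseSeq_ne_one {E : Type*} [NormedAddCommGroup E]
    [InnerProductSpace ℝ E] [TopologicalSpace.SeparableSpace E] :
    ⋃ n, {x : E | Real.cos (inner ℝ x (TopologicalSpace.denseSeq E n)) ≠ 1} = {0}ᶜ := by
  ext x
  simp only [Set.mem_iUnion, Set.mem_compl_iff, Set.mem_singleton_iff]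
  constructor
  · rintro ⟨n, hn⟩ rfl
    simp at hn
  · intro hx
    have hopen : IsOpen {w : E | Real.cos (inner ℝ x w) ≠ 1} :=
      isOpen_ne_fun (by fun_prop) continuous_const
    refine (TopologicalSpace.denseRange_denseSeq E).exists_mem_open hopen
      ⟨(‖x‖ ^ 2)⁻¹ • x, ?_⟩
    have : ‖x‖ ≠ 0 := norm_ne_zero_iff.2 hx
    rw [Set.mem_ofPred_eq, inner_smul_right, real_inner_self_eq_norm_sq,
      inv_mul_cancel₀ (by positivity)]
    exact (Real.cos_one_le.trans_lt (by norm_num)).ne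

section LevyMeasureUniqueness

variable {E : Type*} [NormedAddCommGroup E] [InnerProductSpace ℝ E] [FiniteDimensional ℝ E]
  [MeasurableSpace E] [BorelSpace E] {μ ρ ρ₁ ρ₂ : Measure E}

namespace IsLevyMeasure

lemma integrable_min_one_norm_sq (h : IsLevyMeasure μ ρ) :
    Integrable (fun x ↦ min 1 (‖x‖ ^ 2)) ρ := by
  refine ⟨(by fun_prop : Measurable fun x : E ↦ min 1 (‖x‖ ^ 2)).aestronglyMeasurable, ?_⟩
  rw [hasFiniteIntegral_iff_ofReal (Eventually.of_forall fun x ↦ by positivity)]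
  exact h.2.1

lemma ae_ne_zero (h : IsLevyMeasure μ ρ) : ∀ᵐ x ∂ρ, x ≠ 0 := by
  simpa [ae_iff] using h.1

lemma sigmaFinite (h : IsLevyMeasure μ ρ) : SigmaFinite ρ := by
  refine sigmaFinite_of_lintegral_ne_top
    (f := fun x ↦ ENNReal.ofReal (min 1 (‖x‖ ^ 2))) (by fun_prop) h.2.1.ne ?_
  filter_upwards [h.ae_ne_zero] with x hx
  simp [hx]

lemma exists_isCharExponent_levyExponent (h : IsLevyMeasure μ ρ) :
    ∃ (b : E) (S : E →L[ℝ] E), S.IsPositive ∧ IsCharExponent μ (levyExponent b S ρ) := by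
  obtain ⟨b, S, hS, hμ⟩ := h.2.2
  exact ⟨b, S, hS, continuous_levyExponent h.integrable_min_one_norm_sq b S,
    levyExponent_zero b S ρ, hμ⟩

end IsLevyMeasure

/-- The finite measure `(2 - 2 cos ⟨x, w⟩) ρ(dx) + ⟨S w, w⟩ δ₀`. Its characteristic function is
minus the second difference of the Lévy–Khintchine exponent in the direction `w`, and it determines
`ρ` wherever its density does not vanish. -/
noncomputable def secondDifferenceMeasure (S : E →L[ℝ] E) (ρ : Measure E) (w : E) : Measure E :=
  ρ.withDensity (fun x ↦ ENNReal.ofReal (2 - 2 * Real.cos (inner ℝ x w)))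
    + ENNReal.ofReal (inner ℝ (S w) w) • Measure.dirac 0

lemma two_sub_two_mul_cos_nonneg (y : ℝ) : 0 ≤ 2 - 2 * Real.cos y := by
  linarith [Real.cos_le_one y]

lemma isFiniteMeasure_secondDifferenceMeasure (hρ : Integrable (fun x ↦ min 1 (‖x‖ ^ 2)) ρ)
    (S : E →L[ℝ] E) (w : E) : IsFiniteMeasure (secondDifferenceMeasure S ρ w) := by
  have hcos := (integrable_two_sub_two_mul_cos hρ w).2
  rw [hasFiniteIntegral_iff_ofReal
    (Eventually.of_forall fun x ↦ two_sub_two_mul_cos_nonneg _)] at hcos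
  have := isFiniteMeasure_withDensity hcos.ne
  have : IsFiniteMeasure (ENNReal.ofReal (inner ℝ (S w) w) • Measure.dirac (0 : E)) :=
    Measure.smul_finite _ ENNReal.ofReal_ne_top
  unfold secondDifferenceMeasure
  infer_instance

lemma charFun_secondDifferenceMeasure (hρ : Integrable (fun x ↦ min 1 (‖x‖ ^ 2)) ρ) (b : E)
    {S : E →L[ℝ] E} (hS : S.IsPositive) (u w : E) :
    charFun (secondDifferenceMeasure S ρ w) u
      = -(levyExponent b S ρ (u + w) + levyExponent b S ρ (u - w) - 2 * levyExponent b S ρ u) := by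
  have hfin := isFiniteMeasure_secondDifferenceMeasure hρ S w
  have hint : Integrable (fun x : E ↦ Complex.exp ((inner ℝ x u : ℝ) * Complex.I))
      (secondDifferenceMeasure S ρ w) :=
    Integrable.of_bound (Measurable.aestronglyMeasurable (by fun_prop)) 1
      (Eventually.of_forall fun x ↦ (Complex.norm_exp_ofReal_mul_I _).le)
  rw [levyExponent_add_add_levyExponent_sub hρ, neg_neg, charFun_apply, secondDifferenceMeasure,
    integral_add_measure (hint.mono_measure (Measure.le_add_right le_rfl))
      (hint.mono_measure (Measure.le_add_left le_rfl)),
    integral_smul_measure, integral_dirac,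
    integral_withDensity_eq_integral_toReal_smul (by fun_prop)
      (Eventually.of_forall fun x ↦ ENNReal.ofReal_lt_top)]
  congr 1
  · refine integral_congr_ae (Eventually.of_forall fun x ↦ ?_)
    simp only [ENNReal.toReal_ofReal (two_sub_two_mul_cos_nonneg _), Complex.real_smul]
  · simp [ENNReal.toReal_ofReal (hS.inner_nonneg_left w)]

lemma measurableSet_cos_inner_ne_one (w : E) :
    MeasurableSet {x : E | Real.cos (inner ℝ x w) ≠ 1} :=
  (measurableSet_eq_fun (by fun_prop) measurable_const).compl

lemma restrict_cos_inner_ne_one_eq_withDensity (ρ : Measure E) (S : E →L[ℝ] E) (w : E) :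
    ρ.restrict {x | Real.cos (inner ℝ x w) ≠ 1}
      = ((secondDifferenceMeasure S ρ w).restrict {x | Real.cos (inner ℝ x w) ≠ 1}).withDensity
        (fun x ↦ (ENNReal.ofReal (2 - 2 * Real.cos (inner ℝ x w)))⁻¹) := by
  have hmeas := measurableSet_cos_inner_ne_one w
  have hdirac : (Measure.dirac (0 : E)).restrict {x | Real.cos (inner ℝ x w) ≠ 1} = 0 := by
    rw [Measure.restrict_eq_zero, Measure.dirac_apply' _ hmeas]
    simp
  rw [secondDifferenceMeasure, Measure.restrict_add, Measure.restrict_smul, hdirac, smul_zero,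
    add_zero, restrict_withDensity hmeas, withDensity_inv_same (by fun_prop) ?_
      (Eventually.of_forall fun x ↦ ENNReal.ofReal_ne_top)]
  refine ae_restrict_of_forall_mem hmeas fun x hx ↦ ?_
  have hlt : Real.cos (inner ℝ x w) < 1 := lt_of_le_of_ne (Real.cos_le_one _) hx
  rw [ne_eq, ENNReal.ofReal_eq_zero, not_le]
  linarith

lemma secondDifferenceMeasure_congr (hρ₁ : Integrable (fun x ↦ min 1 (‖x‖ ^ 2)) ρ₁)
    (hρ₂ : Integrable (fun x ↦ min 1 (‖x‖ ^ 2)) ρ₂) {b₁ b₂ : E} {S₁ S₂ : E →L[ℝ] E}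
    (hS₁ : S₁.IsPositive) (hS₂ : S₂.IsPositive)
    (h : levyExponent b₁ S₁ ρ₁ = levyExponent b₂ S₂ ρ₂) (w : E) :
    secondDifferenceMeasure S₁ ρ₁ w = secondDifferenceMeasure S₂ ρ₂ w := by
  have := isFiniteMeasure_secondDifferenceMeasure hρ₁ S₁ w
  have := isFiniteMeasure_secondDifferenceMeasure hρ₂ S₂ w
  refine Measure.ext_of_charFun (funext fun u ↦ ?_)
  rw [charFun_secondDifferenceMeasure hρ₁ b₁ hS₁, charFun_secondDifferenceMeasure hρ₂ b₂ hS₂, h]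

theorem IsLevyMeasure.unique (h₁ : IsLevyMeasure μ ρ₁) (h₂ : IsLevyMeasure μ ρ₂) : ρ₁ = ρ₂ := by
  obtain ⟨b₁, S₁, hS₁, hψ₁⟩ := h₁.exists_isCharExponent_levyExponent
  obtain ⟨b₂, S₂, hS₂, hψ₂⟩ := h₂.exists_isCharExponent_levyExponent
  have hsecond := secondDifferenceMeasure_congr h₁.integrable_min_one_norm_sq
    h₂.integrable_min_one_norm_sq hS₁ hS₂ (hψ₁.unique hψ₂)
  have hrestrict : ρ₁.restrict {0}ᶜ = ρ₂.restrict {0}ᶜ := by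
    rw [← iUnion_cos_inner_denseSeq_ne_one, Measure.restrict_iUnion_congr]
    intro n
    rw [restrict_cos_inner_ne_one_eq_withDensity ρ₁ S₁,
      restrict_cos_inner_ne_one_eq_withDensity ρ₂ S₂, hsecond]
  rwa [Measure.restrict_eq_self_of_ae_mem (by exact h₁.ae_ne_zero),
    Measure.restrict_eq_self_of_ae_mem (by exact h₂.ae_ne_zero)] at hrestrict

end LevyMeasureUniqueness

section ProcessLevyMeasureUniqueness

lemma exists_countable_dependsOn_mem {T : Type*} {α : T → Type*} [∀ t, MeasurableSpace (α t)]
    {A : Set (∀ t, α t)} (hA : MeasurableSet A) :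
    ∃ J : Set T, J.Countable ∧ DependsOn (· ∈ A) J := by
  rw [← generateFrom_measurableCylinders] at hA
  induction A, hA using MeasurableSpace.generateFrom_induction with
  | hC s hs _ =>
    obtain ⟨I, S, -, rfl⟩ := (mem_measurableCylinders _).1 hs
    refine ⟨I, I.countable_toSet, fun f g hfg ↦ ?_⟩
    have hrestrict : I.restrict f = I.restrict g := funext fun i ↦ hfg i i.2
    simp only [mem_cylinder, hrestrict]
  | empty => exact ⟨∅, Set.countable_empty, fun _ _ _ ↦ rfl⟩
  | compl s _ ih =>
    obtain ⟨J, hJ, hs⟩ := ih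
    exact ⟨J, hJ, fun f g hfg ↦ congrArg Not (hs hfg)⟩
  | iUnion s _ ih =>
    choose J hJ hs using ih
    refine ⟨⋃ n, J n, Set.countable_iUnion hJ, fun f g hfg ↦ ?_⟩
    simp only [Set.mem_iUnion]
    exact congrArg Exists (funext fun n ↦ hs n fun t ht ↦ hfg t (Set.mem_iUnion.2 ⟨n, ht⟩))

variable {T : Type*}

lemma iUnion_one_div_lt_abs_eq (t : T) :
    ⋃ n : ℕ, {f : T → ℝ | 1 / ((n : ℝ) + 1) < |f t|} = {f | f t ≠ 0} := by
  ext f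
  simp only [Set.mem_ofPred_eq, Set.mem_iUnion]
  refine ⟨fun ⟨n, hn⟩ ↦ abs_pos.1 (lt_trans (by positivity) hn), fun hf ↦ ?_⟩
  exact exists_nat_one_div_lt (abs_pos.2 hf)

/-- The restriction of a path to finitely many times, as a vector of the Euclidean space in which
`IsProcessLevyMeasure` compares finite-dimensional projections. -/
def euclideanRestrict (I : Finset T) (f : T → ℝ) : EuclideanSpace ℝ I :=
  WithLp.toLp 2 (I.restrict f)

@[simp] lemma euclideanRestrict_apply (I : Finset T) (f : T → ℝ) (i : I) :
    euclideanRestrict I f i = f i := rfl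

@[fun_prop]
lemma measurable_euclideanRestrict (I : Finset T) : Measurable (euclideanRestrict I) := by
  unfold euclideanRestrict
  fun_prop

lemma abs_apply_le_norm_euclideanRestrict {I : Finset T} {t : T} (ht : t ∈ I) (f : T → ℝ) :
    |f t| ≤ ‖euclideanRestrict I f‖ :=
  PiLp.norm_apply_le (euclideanRestrict I f) ⟨t, ht⟩

variable {Ω : Type*} [MeasurableSpace Ω] {P : Measure Ω} {ξ : T → Ω → ℝ}
  {ν ν₁ ν₂ : Measure (T → ℝ)}

namespace IsProcessLevyMeasure

lemma isLevyMeasure_map_euclideanRestrict (h : IsProcessLevyMeasure P ξ ν) (I : Finset T) :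
    IsLevyMeasure (P.map fun ω ↦ euclideanRestrict I (ξ · ω))
      ((ν.map (euclideanRestrict I)).restrict {0}ᶜ) :=
  h.1 I

lemma measure_lt_abs_lt_top (h : IsProcessLevyMeasure P ξ ν) (t : T) {ε : ℝ} (hε : 0 < ε) :
    ν {f | ε < |f t|} < ∞ := by
  have hint := (h.isLevyMeasure_map_euclideanRestrict {t}).integrable_min_one_norm_sq
  refine lt_of_le_of_lt ?_ (hint.measure_norm_ge_lt_top (by positivity : 0 < min 1 (ε ^ 2)))
  have hmeas : MeasurableSet {x : EuclideanSpace ℝ ({t} : Finset T) |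
      min 1 (ε ^ 2) ≤ ‖min 1 (‖x‖ ^ 2)‖} := measurableSet_le (by fun_prop) (by fun_prop)
  rw [Measure.restrict_apply hmeas, Measure.map_apply (by fun_prop)
    (hmeas.inter (measurableSet_singleton 0).compl)]
  refine measure_mono fun f (hf : ε < |f t|) ↦ ?_
  have hnorm : ε < ‖euclideanRestrict {t} f‖ :=
    hf.trans_le (abs_apply_le_norm_euclideanRestrict (Finset.mem_singleton_self t) f)
  refine ⟨?_, norm_pos_iff.1 (hε.trans hnorm)⟩
  rw [Set.mem_ofPred_eq, Real.norm_of_nonneg (by positivity)]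
  gcongr

lemma measure_inter_lt_abs_eq (h₁ : IsProcessLevyMeasure P ξ ν₁)
    (h₂ : IsProcessLevyMeasure P ξ ν₂) (t : T) {ε : ℝ} (hε : 0 < ε) (I : Finset T)
    {S : Set (I → ℝ)} (hS : MeasurableSet S) :
    ν₁ (I.restrict ⁻¹' S ∩ {f | ε < |f t|}) = ν₂ (I.restrict ⁻¹' S ∩ {f | ε < |f t|}) := by
  classical
  set K : Finset T := insert t I
  have hI (i : I) : (i : T) ∈ K := Finset.mem_insert_of_mem i.2
  let D : Set (EuclideanSpace ℝ K) :=
    (fun x (i : I) ↦ x ⟨i, hI i⟩) ⁻¹' S ∩ {x | ε < |x ⟨t, Finset.mem_insert_self t I⟩|}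
  have hD : MeasurableSet D :=
    ((by fun_prop : Measurable fun (x : EuclideanSpace ℝ K) (i : I) ↦ x ⟨i, hI i⟩) hS).inter
      (measurableSet_lt (by fun_prop) (by fun_prop))
  have hD0 : D ⊆ {0}ᶜ := by
    rintro x ⟨-, hx⟩ rfl
    simp only [Set.mem_ofPred_eq, PiLp.zero_apply, abs_zero] at hx
    exact lt_asymm hε hx
  have hproj (ν : Measure (T → ℝ)) : ν (I.restrict ⁻¹' S ∩ {f | ε < |f t|})
      = ((ν.map (euclideanRestrict K)).restrict {0}ᶜ) D := by
    rw [Measure.restrict_apply hD, Set.inter_eq_left.2 hD0, Measure.map_apply (by fun_prop) hD]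
    rfl
  rw [hproj, hproj, (h₁.isLevyMeasure_map_euclideanRestrict K).unique
    (h₂.isLevyMeasure_map_euclideanRestrict K)]

lemma restrict_lt_abs_eq (h₁ : IsProcessLevyMeasure P ξ ν₁) (h₂ : IsProcessLevyMeasure P ξ ν₂)
    (t : T) {ε : ℝ} (hε : 0 < ε) :
    ν₁.restrict {f | ε < |f t|} = ν₂.restrict {f | ε < |f t|} := by
  have : IsFiniteMeasure (ν₁.restrict {f | ε < |f t|}) :=
    ⟨by simpa using h₁.measure_lt_abs_lt_top t hε⟩
  refine IsProjectiveLimit.unique (P := fun I : Finset T ↦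
    (ν₁.restrict {f | ε < |f t|}).map I.restrict) (fun I ↦ rfl) fun I ↦ Measure.ext fun S hS ↦ ?_
  have hrestrict : Measurable (I.restrict : (T → ℝ) → (I → ℝ)) := Finset.measurable_restrict I
  rw [Measure.map_apply hrestrict hS, Measure.map_apply hrestrict hS,
    Measure.restrict_apply (hrestrict hS), Measure.restrict_apply (hrestrict hS),
    h₁.measure_inter_lt_abs_eq h₂ t hε I hS]

lemma restrict_ne_zero_eq (h₁ : IsProcessLevyMeasure P ξ ν₁)
    (h₂ : IsProcessLevyMeasure P ξ ν₂) (t : T) :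
    ν₁.restrict {f | f t ≠ 0} = ν₂.restrict {f | f t ≠ 0} := by
  rw [← iUnion_one_div_lt_abs_eq, Measure.restrict_iUnion_congr]
  exact fun n ↦ h₁.restrict_lt_abs_eq h₂ t (by positivity)

lemma measure_eq_of_zero_notMem (h₁ : IsProcessLevyMeasure P ξ ν₁)
    (h₂ : IsProcessLevyMeasure P ξ ν₂) {B : Set (T → ℝ)} (hB : MeasurableSet B) (h0 : 0 ∉ B) :
    ν₁ B = ν₂ B := by
  obtain ⟨J, hJ, hdep⟩ := exists_countable_dependsOn_mem hB
  have hsub : B ⊆ ⋃ t ∈ J, {f | f t ≠ 0} := by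
    intro f hf
    by_contra hcon
    simp only [Set.mem_iUnion, not_exists, Set.mem_ofPred_eq, not_not] at hcon
    exact h0 ((hdep (y := 0) hcon).mp hf)
  have hunion : ν₁.restrict (⋃ t ∈ J, {f | f t ≠ 0}) = ν₂.restrict (⋃ t ∈ J, {f | f t ≠ 0}) :=
    (Measure.restrict_biUnion_congr hJ).2 fun t _ ↦ h₁.restrict_ne_zero_eq h₂ t
  rw [← Measure.restrict_eq_self ν₁ hsub, hunion, Measure.restrict_eq_self ν₂ hsub]

theorem unique (h₁ : IsProcessLevyMeasure P ξ ν₁) (h₂ : IsProcessLevyMeasure P ξ ν₂) :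
    ν₁ = ν₂ := by
  refine Measure.ext fun A hA ↦ ?_
  rw [h₁.2 A hA, h₂.2 A hA]
  exact iSup_congr fun B ↦ iSup_congr fun hB ↦ iSup_congr fun hBA ↦
    h₁.measure_eq_of_zero_notMem h₂ hB fun h0 ↦ (hBA h0).2 rfl

end IsProcessLevyMeasure

end ProcessLevyMeasureUniqueness

section CeilGrid

/-- The least multiple of `1 / (n + 1)` that is at least `s`. Approximating from the right makes
`y (ceilGrid n s)` converge to `y s` along every right-continuous path `y`. -/
noncomputable def ceilGrid (n : ℕ) (s : ℝ) : ℝ := ⌈s * (n + 1)⌉ / ((n : ℝ) + 1)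

lemma le_ceilGrid (n : ℕ) (s : ℝ) : s ≤ ceilGrid n s := by
  rw [ceilGrid, le_div_iff₀ (by positivity)]
  exact Int.le_ceil _

lemma ceilGrid_lt (n : ℕ) (s : ℝ) : ceilGrid n s < s + 1 / ((n : ℝ) + 1) := by
  have hn : (0 : ℝ) < n + 1 := by positivity
  rw [ceilGrid, div_lt_iff₀ hn, add_mul, one_div, inv_mul_cancel₀ hn.ne']
  exact Int.ceil_lt_add_one _

lemma ceilGrid_le_add_one (n : ℕ) (s : ℝ) : ceilGrid n s ≤ s + 1 := by
  refine (ceilGrid_lt n s).le.trans ?_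
  gcongr
  rw [div_le_one (by positivity)]
  linarith [n.cast_nonneg (α := ℝ)]

lemma tendsto_ceilGrid (s : ℝ) : Tendsto (fun n ↦ ceilGrid n s) atTop (𝓝 s) := by
  have hadd := (tendsto_one_div_add_atTop_nhds_zero_nat (𝕜 := ℝ)).const_add s
  rw [add_zero] at hadd
  exact tendsto_of_tendsto_of_tendsto_of_le_of_le tendsto_const_nhds hadd
    (fun n ↦ le_ceilGrid n s) (fun n ↦ (ceilGrid_lt n s).le)

lemma tendsto_comp_ceilGrid {β : Type*} [TopologicalSpace β] {y : ℝ → β} {s : ℝ}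
    (hy : ContinuousWithinAt y (Set.Ici s) s) :
    Tendsto (fun n ↦ y (ceilGrid n s)) atTop (𝓝 (y s)) :=
  hy.tendsto.comp (tendsto_nhdsWithin_iff.2
    ⟨tendsto_ceilGrid s, Eventually.of_forall fun n ↦ le_ceilGrid n s⟩)

lemma measurable_comp_ceilGrid {β : Type*} [MeasurableSpace β] (y : ℝ → β) (n : ℕ) :
    Measurable fun s ↦ y (ceilGrid n s) := by
  have hgrid : Measurable fun k : ℤ ↦ y (k / ((n : ℝ) + 1)) := measurable_of_countable _
  exact hgrid.comp (Int.measurable_ceil.comp (by fun_prop : Measurable fun s : ℝ ↦ s * (n + 1)))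

lemma measurable_of_continuousWithinAt_Ici {β : Type*} [TopologicalSpace β]
    [TopologicalSpace.PseudoMetrizableSpace β] [MeasurableSpace β] [BorelSpace β] {y : ℝ → β}
    (hy : ∀ s, ContinuousWithinAt y (Set.Ici s) s) : Measurable y :=
  measurable_of_tendsto_metrizable (fun n ↦ measurable_comp_ceilGrid y n)
    (tendsto_pi_nhds.2 fun s ↦ tendsto_comp_ceilGrid (hy s))

lemma exists_nat_mul_eq_ceilGrid (n : ℕ) {s : ℝ} (hs : 0 ≤ s) :
    ∃ k : ℕ, k * (1 / ((n : ℝ) + 1)) = ceilGrid n s := by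
  obtain ⟨k, hk⟩ := Int.eq_ofNat_of_zero_le (Int.ceil_nonneg (by positivity : 0 ≤ s * (n + 1)))
  exact ⟨k, by rw [ceilGrid, hk, mul_one_div, Int.cast_natCast]⟩

end CeilGrid

lemma tendsto_charFun_map_of_ae_tendsto {Ω ι E : Type*} [MeasurableSpace Ω] {P : Measure Ω}
    [IsFiniteMeasure P] [NormedAddCommGroup E] [InnerProductSpace ℝ E] [MeasurableSpace E]
    [BorelSpace E] [SecondCountableTopology E] {l : Filter ι} [l.NeBot] [l.IsCountablyGenerated]
    {V : ι → Ω → E} {W : Ω → E} (hV : ∀ n, AEMeasurable (V n) P)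
    (h : ∀ᵐ ω ∂P, Tendsto (fun n ↦ V n ω) l (𝓝 (W ω))) (u : E) :
    Tendsto (fun n ↦ charFun (P.map (V n)) u) l (𝓝 (charFun (P.map W) u)) := by
  have hW : AEMeasurable W P := aemeasurable_of_tendsto_metrizable_ae l hV h
  have hcont : Continuous fun x : E ↦ Complex.exp ((inner ℝ x u : ℝ) * Complex.I) := by fun_prop
  have hcharFun (Z : Ω → E) (hZ : AEMeasurable Z P) : charFun (P.map Z) u
      = ∫ ω, Complex.exp ((inner ℝ (Z ω) u : ℝ) * Complex.I) ∂P := by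
    rw [charFun_apply, integral_map hZ hcont.aestronglyMeasurable]
  simp_rw [hcharFun W hW, fun n ↦ hcharFun (V n) (hV n)]
  refine tendsto_integral_filter_of_dominated_convergence (fun _ ↦ 1)
    (Eventually.of_forall fun n ↦ ?_)
    (Eventually.of_forall fun n ↦ Eventually.of_forall fun ω ↦ ?_) (integrable_const 1) ?_
  · exact (hcont.measurable.comp_aemeasurable (hV n)).aestronglyMeasurable
  · rw [Complex.norm_exp_ofReal_mul_I]
  · filter_upwards [h] with ω hω
    exact (hcont.tendsto _).comp hω

lemma eq_exp_div_of_pow_eq_exp {X : Type*} [TopologicalSpace X] [PreconnectedSpace X]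
    {φ ψ : X → ℂ} (hφ : Continuous φ) (hψ : Continuous ψ) {n : ℕ} (hn : n ≠ 0)
    (h : ∀ x, φ x ^ n = Complex.exp (ψ x)) {x₀ : X} (hφ₀ : φ x₀ = 1) (hψ₀ : ψ x₀ = 0) (x : X) :
    φ x = Complex.exp (ψ x / n) := by
  have hn' : (n : ℂ) ≠ 0 := Nat.cast_ne_zero.2 hn
  have hroot (x : X) : (φ x * Complex.exp (-(ψ x / n))) ^ n = 1 := by
    rw [mul_pow, h, ← Complex.exp_nat_mul, ← Complex.exp_add, mul_neg, mul_div_cancel₀ _ hn',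
      add_neg_cancel, Complex.exp_zero]
  have hfinite : Set.Finite {z : ℂ | z ^ n = 1} := by
    refine (Polynomial.nthRoots n (1 : ℂ)).toFinset.finite_toSet.subset fun z hz ↦ ?_
    simpa [Polynomial.mem_nthRoots (Nat.pos_of_ne_zero hn)] using hz
  have hconst := isPreconnected_univ.constant_of_mapsTo hfinite.isDiscrete
    (f := fun x ↦ φ x * Complex.exp (-(ψ x / n))) (Continuous.continuousOn (by fun_prop))
    (fun x _ ↦ hroot x) (Set.mem_univ x) (Set.mem_univ x₀)
  simp only [hφ₀, hψ₀, zero_div, neg_zero, Complex.exp_zero, mul_one] at hconst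
  rw [Complex.exp_neg] at hconst
  exact eq_of_mul_inv_eq_one hconst

section Increments

variable {Ω : Type*} [MeasurableSpace Ω] {P : Measure Ω} {Y : ℝ → Ω → ℝ}

lemma charFun_map_sum_mul_sub {τ : ℕ → ℝ} (hY : ∀ s, Measurable (Y s))
    (hindep : HasIndepIncrements Y P) (hτ : Monotone τ) (c : ℕ → ℝ) (N : ℕ) (u : ℝ) :
    charFun (P.map fun ω ↦ ∑ i ∈ Finset.range N, c i * (Y (τ (i + 1)) ω - Y (τ i) ω)) u
      = ∏ i ∈ Finset.range N, charFun (P.map fun ω ↦ Y (τ (i + 1)) ω - Y (τ i) ω) (c i * u) := by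
  have hmeas (i : ℕ) : Measurable fun ω ↦ Y (τ (i + 1)) ω - Y (τ i) ω := (hY _).sub (hY _)
  have hscaled := (hindep.nat hτ).comp (fun i x ↦ c i * x) (fun i ↦ by fun_prop)
  have hprod := congrFun (iIndepFun.charFun_map_fun_finsetSum_eq_prod (P := P)
    (s := Finset.range N) (X := fun i ω ↦ c i * (Y (τ (i + 1)) ω - Y (τ i) ω))
    (fun i _ ↦ ((hmeas i).const_mul (c i)).aemeasurable)
    (hscaled.precomp (g := fun i : Finset.range N ↦ (i : ℕ)) Subtype.val_injective)) u
  rw [hprod, Finset.prod_apply]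
  exact Finset.prod_congr rfl fun i _ ↦ charFun_map_mul_comp (hmeas i).aemeasurable (c i) u

namespace IsTwoSidedLevyProcess

lemma measurable_sub (hY : IsTwoSidedLevyProcess P Y) (s t : ℝ) :
    Measurable fun ω ↦ Y t ω - Y s ω :=
  (hY.measurable t).sub (hY.measurable s)

lemma map_sub_eq_map_sub_zero (hY : IsTwoSidedLevyProcess P Y) (s t : ℝ) :
    P.map (fun ω ↦ Y t ω - Y s ω) = P.map (fun ω ↦ Y (t - s) ω - Y 0 ω) := by
  simpa using (hY.stationary 0 (t - s) s).map_eq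

lemma charFun_sub_zero_nat_mul (hY : IsTwoSidedLevyProcess P Y) {d : ℝ} (hd : 0 ≤ d) (k : ℕ)
    (u : ℝ) :
    charFun (P.map fun ω ↦ Y (k * d) ω - Y 0 ω) u
      = charFun (P.map fun ω ↦ Y d ω - Y 0 ω) u ^ k := by
  have hmono : Monotone fun i : ℕ ↦ (i : ℝ) * d := fun i j hij ↦ by
    beta_reduce
    gcongr
  have hprod := charFun_map_sum_mul_sub hY.measurable hY.indep hmono 1 k u
  have htelescope (ω : Ω) : ∑ i ∈ Finset.range k, (Y ((i + 1 : ℕ) * d) ω - Y ((i : ℕ) * d) ω)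
      = Y (k * d) ω - Y 0 ω := by
    rw [Finset.sum_range_sub (fun i : ℕ ↦ Y (i * d) ω), Nat.cast_zero, zero_mul]
  have hstep (i : ℕ) : ((i + 1 : ℕ) : ℝ) * d - (i : ℕ) * d = d := by push_cast; ring
  simp_rw [Pi.one_apply, one_mul, htelescope, hY.map_sub_eq_map_sub_zero (_ * d), hstep] at hprod
  rw [hprod, Finset.prod_const, Finset.card_range]

variable [IsProbabilityMeasure P] {ψ : ℝ → ℂ}

lemma charFun_sub_zero_one_div (hY : IsTwoSidedLevyProcess P Y)
    (hψ : IsCharExponent (P.map (Y 1)) ψ) (n : ℕ) (u : ℝ) :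
    charFun (P.map fun ω ↦ Y (1 / ((n : ℝ) + 1)) ω - Y 0 ω) u
      = Complex.exp (ψ u / (n + 1 : ℕ)) := by
  have := Measure.isProbabilityMeasure_map (μ := P)
    (hY.measurable_sub 0 (1 / ((n : ℝ) + 1))).aemeasurable
  refine eq_exp_div_of_pow_eq_exp (φ := charFun _) continuous_charFun hψ.continuous n.succ_ne_zero
    (fun w ↦ ?_) (x₀ := 0) (by rw [charFun_zero, probReal_univ]; rfl) hψ.map_zero u
  rw [← hY.charFun_sub_zero_nat_mul (by positivity), ← hψ.charFun_eq_exp w]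
  congr 1
  refine Measure.map_congr ?_
  have hone : ((n + 1 : ℕ) : ℝ) * (1 / ((n : ℝ) + 1)) = 1 := by
    push_cast
    field_simp
  filter_upwards [hY.zero] with ω hω
  simp only [hone, hω, sub_zero]

lemma charFun_sub_zero_ceilGrid (hY : IsTwoSidedLevyProcess P Y)
    (hψ : IsCharExponent (P.map (Y 1)) ψ) (n : ℕ) {h : ℝ} (hh : 0 ≤ h) (u : ℝ) :
    charFun (P.map fun ω ↦ Y (ceilGrid n h) ω - Y 0 ω) u = Complex.exp (ceilGrid n h * ψ u) := by
  obtain ⟨k, hk⟩ := exists_nat_mul_eq_ceilGrid n hh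
  rw [← hk, hY.charFun_sub_zero_nat_mul (by positivity), hY.charFun_sub_zero_one_div hψ,
    ← Complex.exp_nat_mul]
  congr 1
  push_cast
  ring

theorem charFun_sub (hY : IsTwoSidedLevyProcess P Y) (hψ : IsCharExponent (P.map (Y 1)) ψ)
    {s t : ℝ} (hst : s ≤ t) (u : ℝ) :
    charFun (P.map fun ω ↦ Y t ω - Y s ω) u = Complex.exp ((t - s : ℝ) * ψ u) := by
  rw [hY.map_sub_eq_map_sub_zero]
  have hlim : Tendsto (fun n ↦ charFun (P.map fun ω ↦ Y (ceilGrid n (t - s)) ω - Y 0 ω) u) atTop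
      (𝓝 (charFun (P.map fun ω ↦ Y (t - s) ω - Y 0 ω) u)) := by
    refine tendsto_charFun_map_of_ae_tendsto (fun n ↦ (hY.measurable_sub 0 _).aemeasurable) ?_ u
    filter_upwards [hY.cadlag] with ω hω
    exact (tendsto_comp_ceilGrid (hω (t - s)).1).sub_const _
  refine tendsto_nhds_unique hlim ?_
  simp_rw [hY.charFun_sub_zero_ceilGrid hψ _ (sub_nonneg.2 hst)]
  have hcont : Continuous fun r : ℝ ↦ Complex.exp (r * ψ u) := by fun_prop
  exact (hcont.tendsto _).comp (tendsto_ceilGrid _)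

theorem charFun_sum_mul_sub (hY : IsTwoSidedLevyProcess P Y)
    (hψ : IsCharExponent (P.map (Y 1)) ψ) {τ : ℕ → ℝ} (hτ : Monotone τ) (c : ℕ → ℝ) (N : ℕ) :
    charFun (P.map fun ω ↦ ∑ i ∈ Finset.range N, c i * (Y (τ (i + 1)) ω - Y (τ i) ω)) 1
      = Complex.exp (∑ i ∈ Finset.range N, (τ (i + 1) - τ i : ℝ) * ψ (c i)) := by
  rw [charFun_map_sum_mul_sub hY.measurable hY.indep hτ, Complex.exp_sum]
  exact Finset.prod_congr rfl fun i _ ↦ by rw [mul_one, hY.charFun_sub hψ (hτ i.le_succ)]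

end IsTwoSidedLevyProcess

end Increments

section GridPoint

/-- The `i`-th point of the grid of mesh `1 / (n + 1)` that starts at the integer `A`. As `A` is an
integer, these are values of `ceilGrid n`. -/
noncomputable def gridPoint (A : ℤ) (n i : ℕ) : ℝ := A + i / ((n : ℝ) + 1)

lemma gridPoint_succ_sub (A : ℤ) (n i : ℕ) :
    gridPoint A n (i + 1) - gridPoint A n i = 1 / ((n : ℝ) + 1) := by
  rw [gridPoint, gridPoint]
  push_cast
  ring

lemma strictMono_gridPoint (A : ℤ) (n : ℕ) : StrictMono (gridPoint A n) := by
  refine strictMono_nat_of_lt_succ fun i ↦ sub_pos.1 ?_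
  rw [gridPoint_succ_sub]
  positivity

lemma gridPoint_zero (A : ℤ) (n : ℕ) : gridPoint A n 0 = A := by
  simp [gridPoint]

lemma gridPoint_mul_succ (A : ℤ) (n L : ℕ) : gridPoint A n (L * (n + 1)) = A + L := by
  rw [gridPoint]
  push_cast
  field_simp

lemma gridPoint_eq_div (A : ℤ) (n i : ℕ) :
    gridPoint A n i = ((A * (n + 1) + i : ℤ) : ℝ) / ((n : ℝ) + 1) := by
  rw [gridPoint]
  push_cast
  field_simp

lemma ceilGrid_eq_gridPoint {A : ℤ} {n i : ℕ} {s : ℝ}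
    (hs : s ∈ Set.uIoc (gridPoint A n i) (gridPoint A n (i + 1))) :
    ceilGrid n s = gridPoint A n (i + 1) := by
  have hn : (0 : ℝ) < n + 1 := by positivity
  rw [Set.uIoc_of_le (strictMono_gridPoint A n i.lt_succ_self).le, gridPoint_eq_div,
    gridPoint_eq_div, Set.mem_Ioc, div_lt_iff₀ hn, le_div_iff₀ hn] at hs
  have hceil : ⌈s * (n + 1)⌉ = A * (n + 1) + (i + 1 : ℕ) := by
    refine Int.ceil_eq_iff.2 ⟨lt_of_eq_of_lt ?_ hs.1, hs.2⟩
    push_cast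
    ring
  rw [gridPoint_eq_div, ceilGrid, hceil]

lemma exists_gridPoint_eq_ceilGrid {A : ℤ} (n : ℕ) {a : ℝ} (ha : A ≤ a) :
    ∃ k : ℕ, gridPoint A n k = ceilGrid n a ∧ ∀ i, a ≤ gridPoint A n i ↔ k ≤ i := by
  have hn : (0 : ℝ) < n + 1 := by positivity
  have hle : A * (n + 1) ≤ ⌈a * (n + 1)⌉ := by
    have hle' : ((A * (n + 1) : ℤ) : ℝ) ≤ ⌈a * (n + 1)⌉ := by
      refine le_trans ?_ (Int.le_ceil _)
      push_cast
      gcongr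
    exact_mod_cast hle'
  obtain ⟨k, hk⟩ := Int.eq_ofNat_of_zero_le (sub_nonneg.2 hle)
  have hceil : ⌈a * (n + 1)⌉ = A * (n + 1) + k := by lia
  refine ⟨k, by rw [gridPoint_eq_div, ceilGrid, hceil], fun i ↦ ?_⟩
  rw [gridPoint_eq_div, le_div_iff₀ hn, ← Int.ceil_le, hceil]
  lia

variable {E : Type*} [NormedAddCommGroup E] [NormedSpace ℝ E]

lemma intervalIntegrable_smul_comp_ceilGrid {g : ℝ → ℝ} (hg : Continuous g) (y : ℝ → E)
    (A : ℤ) (n i : ℕ) :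
    IntervalIntegrable (fun s ↦ g s • y (ceilGrid n s)) volume
      (gridPoint A n i) (gridPoint A n (i + 1)) := by
  refine IntervalIntegrable.congr (f := fun s ↦ g s • y (gridPoint A n (i + 1))) (fun s hs ↦ ?_)
    ((by fun_prop : Continuous fun s ↦ g s • y (gridPoint A n (i + 1))).intervalIntegrable _ _)
  simp only [ceilGrid_eq_gridPoint hs]

lemma integral_smul_comp_ceilGrid [CompleteSpace E] (g : ℝ → ℝ) (y : ℝ → E) (A : ℤ) (n i : ℕ) :
    ∫ s in gridPoint A n i..gridPoint A n (i + 1), g s • y (ceilGrid n s)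
      = (∫ s in gridPoint A n i..gridPoint A n (i + 1), g s) • y (gridPoint A n (i + 1)) := by
  rw [← intervalIntegral.integral_smul_const]
  refine intervalIntegral.integral_congr_ae (Eventually.of_forall fun s hs ↦ ?_)
  rw [ceilGrid_eq_gridPoint hs]

end GridPoint

section RiemannSums

lemma sum_Ico_mul_sub_gridPoint {g : ℝ → ℝ} (hg : ContDiff ℝ 1 g) (y : ℝ → ℝ) (A : ℤ) (n : ℕ)
    {k l : ℕ} (hkl : k ≤ l) :
    ∑ i ∈ Finset.Ico k l, g (gridPoint A n i) * (y (gridPoint A n (i + 1)) - y (gridPoint A n i))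
      = g (gridPoint A n l) * y (gridPoint A n l) - g (gridPoint A n k) * y (gridPoint A n k)
        - ∫ s in gridPoint A n k..gridPoint A n l, deriv g s * y (ceilGrid n s) := by
  have hderiv := hg.continuous_deriv_one
  simp only [← smul_eq_mul (deriv g _)]
  rw [← intervalIntegral.sum_integral_adjacent_intervals_Ico hkl
      (fun i _ ↦ intervalIntegrable_smul_comp_ceilGrid hderiv y A n i),
    ← Finset.sum_Ico_sub (fun i ↦ g (gridPoint A n i) * y (gridPoint A n i)) hkl,
    ← Finset.sum_sub_distrib]
  refine Finset.sum_congr rfl fun i _ ↦ ?_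
  have hcell := integral_smul_comp_ceilGrid (deriv g) y A n i
  rw [intervalIntegral.integral_deriv_eq_sub (fun s _ ↦ hg.differentiable_one s)
    (hderiv.intervalIntegrable _ _), smul_eq_mul] at hcell
  rw [hcell]
  ring

lemma sum_indicator_mul_sub_gridPoint {g : ℝ → ℝ} (hg : ContDiff ℝ 1 g) (y : ℝ → ℝ) {A : ℤ}
    {L : ℕ} (n : ℕ) {a b : ℝ} (hAa : A ≤ a) (hab : a ≤ b) (hbL : b ≤ A + L) :
    ∑ i ∈ Finset.range (L * (n + 1)), (Set.Ico a b).indicator g (gridPoint A n i) *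
        (y (gridPoint A n (i + 1)) - y (gridPoint A n i))
      = g (ceilGrid n b) * y (ceilGrid n b) - g (ceilGrid n a) * y (ceilGrid n a)
        - ∫ s in ceilGrid n a..ceilGrid n b, deriv g s * y (ceilGrid n s) := by
  obtain ⟨k, hk, hk'⟩ := exists_gridPoint_eq_ceilGrid n hAa
  obtain ⟨l, hl, hl'⟩ := exists_gridPoint_eq_ceilGrid n (hAa.trans hab)
  have hkl : k ≤ l := (hk' l).1 (hab.trans ((hl' l).2 le_rfl))
  have hlL : l ≤ L * (n + 1) := (hl' _).1 (by rwa [gridPoint_mul_succ])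
  have hmem (i : ℕ) : gridPoint A n i ∈ Set.Ico a b ↔ i ∈ Finset.Ico k l := by
    rw [Set.mem_Ico, Finset.mem_Ico, hk', ← not_le, hl', not_le]
  have hsub : Finset.Ico k l ⊆ Finset.range (L * (n + 1)) := fun i hi ↦
    Finset.mem_range.2 ((Finset.mem_Ico.1 hi).2.trans_le hlL)
  rw [← hk, ← hl, ← sum_Ico_mul_sub_gridPoint hg y A n hkl, ← Finset.sum_subset hsub]
  · exact Finset.sum_congr rfl fun i hi ↦ by rw [Set.indicator_of_mem ((hmem i).2 hi)]
  · exact fun i _ hi ↦ by rw [Set.indicator_of_notMem (mt (hmem i).1 hi), zero_mul]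

lemma tendsto_intervalIntegral_of_bounded {E : Type*} [NormedAddCommGroup E] [NormedSpace ℝ E]
    {F : ℕ → ℝ → E} {f : ℝ → E} {α β : ℕ → ℝ} {a b c d K : ℝ}
    (hF : ∀ n, AEStronglyMeasurable (F n)) (hbound : ∀ n, ∀ s ∈ Set.Icc c d, ‖F n s‖ ≤ K)
    (hlim : ∀ s ∈ Set.Icc c d, Tendsto (fun n ↦ F n s) atTop (𝓝 (f s)))
    (ha : a ∈ Set.Icc c d) (hb : b ∈ Set.Icc c d)
    (hα : Tendsto α atTop (𝓝 a)) (hα' : ∀ n, α n ∈ Set.Icc c d)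
    (hβ : Tendsto β atTop (𝓝 b)) (hβ' : ∀ n, β n ∈ Set.Icc c d) :
    Tendsto (fun n ↦ ∫ s in α n..β n, F n s) atTop (𝓝 (∫ s in a..b, f s)) := by
  have hsub {p q : ℝ} (hp : p ∈ Set.Icc c d) (hq : q ∈ Set.Icc c d) :
      Set.uIoc p q ⊆ Set.Icc c d := Set.uIoc_subset_uIcc.trans (Set.uIcc_subset_Icc hp hq)
  have hint (n : ℕ) {p q : ℝ} (hp : p ∈ Set.Icc c d) (hq : q ∈ Set.Icc c d) :
      IntervalIntegrable (F n) volume p q :=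
    intervalIntegrable_iff.2 ((Measure.integrableOn_of_bounded measure_Icc_lt_top.ne (hF n)
      ((ae_restrict_iff' measurableSet_Icc).2 (Eventually.of_forall (hbound n)))).mono_set
        (hsub hp hq))
  have hfixed : Tendsto (fun n ↦ ∫ s in a..b, F n s) atTop (𝓝 (∫ s in a..b, f s)) :=
    intervalIntegral.tendsto_integral_filter_of_dominated_convergence (fun _ ↦ K)
      (Eventually.of_forall fun n ↦ (hF n).restrict)
      (Eventually.of_forall fun n ↦ Eventually.of_forall fun s hs ↦ hbound n s (hsub ha hb hs))
      intervalIntegrable_const (Eventually.of_forall fun s hs ↦ hlim s (hsub ha hb hs))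
  have hboundary {γ : ℕ → ℝ} {p : ℝ} (hp : p ∈ Set.Icc c d) (hγ : Tendsto γ atTop (𝓝 p))
      (hγ' : ∀ n, γ n ∈ Set.Icc c d) : Tendsto (fun n ↦ ∫ s in p..γ n, F n s) atTop (𝓝 0) := by
    have hzero : Tendsto (fun n ↦ K * |γ n - p|) atTop (𝓝 0) := by
      simpa using ((hγ.sub_const p).abs.const_mul K)
    exact squeeze_zero_norm (fun n ↦ intervalIntegral.norm_integral_le_of_norm_le_const
      fun s hs ↦ hbound n s (hsub hp (hγ' n) hs)) hzero
  have hsplit (n : ℕ) : (∫ s in a..b, F n s) - (∫ s in a..α n, F n s) + ∫ s in b..β n, F n s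
      = ∫ s in α n..β n, F n s := by
    rw [intervalIntegral.integral_interval_sub_left (hint n ha hb) (hint n ha (hα' n)),
      intervalIntegral.integral_add_adjacent_intervals (hint n (hα' n) hb) (hint n hb (hβ' n))]
  simpa [hsplit] using (hfixed.sub (hboundary ha hα hα')).add (hboundary hb hβ hβ')

lemma sum_gridPoint_smul_eq_integral {E : Type*} [NormedAddCommGroup E] [NormedSpace ℝ E]
    [CompleteSpace E] {Φ : ℝ → E} {A : ℤ} {L : ℕ} (hA : Φ A = 0) (hL : Φ (A + L) = 0) (n : ℕ) :
    ∑ i ∈ Finset.range (L * (n + 1)),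
      (gridPoint A n (i + 1) - gridPoint A n i) • Φ (gridPoint A n i)
      = ∫ s in (A : ℝ)..A + L, Φ (ceilGrid n s) := by
  have hshift : ∑ i ∈ Finset.range (L * (n + 1)), Φ (gridPoint A n i)
      = ∑ i ∈ Finset.range (L * (n + 1)), Φ (gridPoint A n (i + 1)) := by
    have htelescope := Finset.sum_range_sub (fun i ↦ Φ (gridPoint A n i)) (L * (n + 1))
    rw [gridPoint_mul_succ, gridPoint_zero, hA, hL, sub_zero, Finset.sum_sub_distrib,
      sub_eq_zero] at htelescope
    exact htelescope.symm
  have hcell (i : ℕ) := integral_smul_comp_ceilGrid (fun _ ↦ 1) Φ A n i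
  have hint (i : ℕ) := intervalIntegrable_smul_comp_ceilGrid (continuous_const (y := 1)) Φ A n i
  simp only [one_smul, integral_one] at hcell hint
  rw [← gridPoint_mul_succ A n L, ← gridPoint_zero A n,
    ← intervalIntegral.sum_integral_adjacent_intervals (fun i _ ↦ hint i)]
  simp_rw [hcell, gridPoint_succ_sub, ← Finset.smul_sum, hshift]

lemma tendsto_sum_gridPoint_smul {E : Type*} [NormedAddCommGroup E] [NormedSpace ℝ E]
    [CompleteSpace E] [MeasurableSpace E] [BorelSpace E] [SecondCountableTopology E] {Φ : ℝ → E}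
    {M : ℝ} (hM : ∀ s, ‖Φ s‖ ≤ M) (hΦ : ∀ s, ContinuousWithinAt Φ (Set.Ici s) s) {A : ℤ} {L : ℕ}
    (hA : Φ A = 0) (hL : Φ (A + L) = 0) :
    Tendsto (fun n ↦ ∑ i ∈ Finset.range (L * (n + 1)),
      (gridPoint A n (i + 1) - gridPoint A n i) • Φ (gridPoint A n i)) atTop
      (𝓝 (∫ s in (A : ℝ)..A + L, Φ s)) := by
  simp_rw [sum_gridPoint_smul_eq_integral hA hL]
  exact intervalIntegral.tendsto_integral_filter_of_dominated_convergence (fun _ ↦ M)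
    (Eventually.of_forall fun n ↦ (measurable_comp_ceilGrid Φ n).aestronglyMeasurable)
    (Eventually.of_forall fun n ↦ Eventually.of_forall fun s _ ↦ hM _) intervalIntegrable_const
    (Eventually.of_forall fun s _ ↦ tendsto_comp_ceilGrid (hΦ s))

end RiemannSums

section Cadlag

/-- Right-continuity with left limits. -/
def IsCadlag {E : Type*} [TopologicalSpace E] (y : ℝ → E) : Prop :=
  ∀ s, ContinuousWithinAt y (Set.Ici s) s ∧ ∃ l, Tendsto y (𝓝[<] s) (𝓝 l)

lemma IsCadlag.exists_forall_norm_le {E : Type*} [SeminormedAddCommGroup E] {y : ℝ → E}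
    (hy : IsCadlag y) (a b : ℝ) : ∃ M, ∀ s ∈ Set.Icc a b, ‖y s‖ ≤ M := by
  refine isCompact_Icc.induction_on (p := fun S ↦ ∃ M, ∀ s ∈ S, ‖y s‖ ≤ M) ⟨0, by simp⟩
    (fun S T hST ⟨M, hM⟩ ↦ ⟨M, fun s hs ↦ hM s (hST hs)⟩) ?_ fun s _ ↦ ?_
  · rintro S T ⟨M, hM⟩ ⟨M', hM'⟩
    refine ⟨max M M', ?_⟩
    rintro s (hs | hs)
    exacts [(hM s hs).trans (le_max_left _ _), (hM' s hs).trans (le_max_right _ _)]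
  · obtain ⟨hright, l, hl⟩ := hy s
    have hge : ∀ᶠ r in 𝓝[≥] s, ‖y r‖ < ‖y s‖ + 1 :=
      hright.tendsto.norm.eventually_lt_const (lt_add_one _)
    have hlt : ∀ᶠ r in 𝓝[<] s, ‖y r‖ < ‖l‖ + 1 := hl.norm.eventually_lt_const (lt_add_one _)
    refine ⟨{r | ‖y r‖ ≤ max (‖y s‖ + 1) (‖l‖ + 1)}, mem_nhdsWithin_of_mem_nhds ?_, _,
      fun r hr ↦ hr⟩
    rw [← nhdsLT_sup_nhdsGE s]
    exact mem_sup.2 ⟨hlt.mono fun r h ↦ h.le.trans (le_max_right _ _),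
      hge.mono fun r h ↦ h.le.trans (le_max_left _ _)⟩

lemma tendsto_sum_indicator_mul_sub_pathIntegral {g y : ℝ → ℝ} (hg : ContDiff ℝ 1 g)
    (hy : IsCadlag y) {A : ℤ} {L : ℕ} {a b : ℝ} (hAa : A ≤ a) (hab : a ≤ b) (hbL : b ≤ A + L) :
    Tendsto (fun n ↦ ∑ i ∈ Finset.range (L * (n + 1)),
      (Set.Ico a b).indicator g (gridPoint A n i) *
        (y (gridPoint A n (i + 1)) - y (gridPoint A n i))) atTop (𝓝 (pathIntegral g y a b)) := by
  have hderiv := hg.continuous_deriv_one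
  obtain ⟨M, hM⟩ := hy.exists_forall_norm_le a (b + 2)
  obtain ⟨K, hK⟩ := (isCompact_Icc (a := a) (b := b + 1)).exists_bound_of_continuousOn
    hderiv.continuousOn
  have hbound (n : ℕ) : ∀ s ∈ Set.Icc a (b + 1), ‖deriv g s * y (ceilGrid n s)‖ ≤ K * M := by
    intro s hs
    have hgrid : ceilGrid n s ∈ Set.Icc a (b + 2) :=
      ⟨hs.1.trans (le_ceilGrid n s), by linarith [ceilGrid_le_add_one n s, hs.2]⟩
    rw [norm_mul]
    exact mul_le_mul (hK s hs) (hM _ hgrid) (norm_nonneg _) ((norm_nonneg _).trans (hK s hs))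
  have hgrid {s : ℝ} (hs : s ∈ Set.Icc a b) (n : ℕ) : ceilGrid n s ∈ Set.Icc a (b + 1) :=
    ⟨hs.1.trans (le_ceilGrid n s), by linarith [ceilGrid_le_add_one n s, hs.2]⟩
  have hendpoint (s : ℝ) : Tendsto (fun n ↦ g (ceilGrid n s) * y (ceilGrid n s)) atTop
      (𝓝 (g s * y s)) :=
    tendsto_comp_ceilGrid (y := fun s ↦ g s * y s)
      (hg.continuous.continuousWithinAt.mul (hy s).1)
  have hintegral := tendsto_intervalIntegral_of_bounded (fun n ↦ (hderiv.measurable.mul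
      (measurable_comp_ceilGrid y n)).aestronglyMeasurable) hbound
    (fun s _ ↦ (tendsto_comp_ceilGrid (hy s).1).const_mul (deriv g s))
    ⟨le_rfl, by linarith⟩ ⟨hab, by linarith⟩ (tendsto_ceilGrid a) (hgrid ⟨le_rfl, hab⟩)
    (tendsto_ceilGrid b) (hgrid ⟨hab, le_rfl⟩)
  simp_rw [sum_indicator_mul_sub_gridPoint hg y _ hAa hab hbL, pathIntegral, mul_comm (y _)]
  exact ((hendpoint b).sub (hendpoint a)).sub hintegral

lemma continuousWithinAt_Ici_indicator_Ico {g : ℝ → ℝ} (hg : Continuous g) (a b s : ℝ) :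
    ContinuousWithinAt ((Set.Ico a b).indicator g) (Set.Ici s) s := by
  rcases lt_or_ge s a with hsa | has
  · refine ContinuousAt.continuousWithinAt (continuousAt_const.congr (f := 0) ?_)
    filter_upwards [Iio_mem_nhds hsa] with r hr
    rw [Set.indicator_of_notMem (fun hr' ↦ (not_le.2 hr) hr'.1), Pi.zero_apply]
  rcases lt_or_ge s b with hsb | hbs
  · refine hg.continuousWithinAt.congr_of_eventuallyEq ?_
      (Set.indicator_of_mem (s := Set.Ico a b) ⟨has, hsb⟩ _)
    filter_upwards [mem_nhdsWithin_of_mem_nhds (Iio_mem_nhds hsb), self_mem_nhdsWithin]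
      with r hrb hsr
    exact Set.indicator_of_mem (s := Set.Ico a b) ⟨has.trans hsr, hrb⟩ _
  · have hzero (r : ℝ) (hr : r ∈ Set.Ici s) : (Set.Ico a b).indicator g r = 0 :=
      Set.indicator_of_notMem (fun hr' ↦ (not_lt.2 (hbs.trans hr)) hr'.2) _
    exact continuousWithinAt_const.congr hzero (hzero s Set.self_mem_Ici)

lemma exists_forall_abs_indicator_Ico_le {g : ℝ → ℝ} (hg : Continuous g) (a b : ℝ) :
    ∃ K, ∀ s, |(Set.Ico a b).indicator g s| ≤ K := by
  obtain ⟨K, hK⟩ := (isCompact_Icc (a := a) (b := b)).exists_bound_of_continuousOn hg.continuousOn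
  refine ⟨max K 0, fun s ↦ ?_⟩
  by_cases hs : s ∈ Set.Ico a b
  · rw [Set.indicator_of_mem hs]
    exact (hK s (Set.Ico_subset_Icc_self hs)).trans (le_max_left _ _)
  · rw [Set.indicator_of_notMem hs, abs_zero]
    exact le_max_right _ _

end Cadlag

section PathIntegral

lemma pathIntegral_const_mul (c : ℝ) (g y : ℝ → ℝ) (a b : ℝ) :
    pathIntegral (fun s ↦ c * g s) y a b = c * pathIntegral g y a b := by
  simp_rw [pathIntegral, deriv_const_mul_field', mul_left_comm (y _), mul_sub,
    intervalIntegral.integral_const_mul, mul_assoc]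

variable {Ω : Type*} [MeasurableSpace Ω] {P : Measure Ω} {Y : ℝ → Ω → ℝ}

namespace IsTwoSidedLevyProcess

lemma ae_isCadlag (hY : IsTwoSidedLevyProcess P Y) : ∀ᵐ ω ∂P, IsCadlag fun s ↦ Y s ω :=
  hY.cadlag

lemma measurable_sum_mul_sub (hY : IsTwoSidedLevyProcess P Y) (c τ : ℕ → ℝ) (N : ℕ) :
    Measurable fun ω ↦ ∑ i ∈ Finset.range N, c i * (Y (τ (i + 1)) ω - Y (τ i) ω) :=
  Finset.measurable_fun_sum _ fun i _ ↦ (hY.measurable_sub _ _).const_mul (c i)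

lemma aemeasurable_pathIntegral (hY : IsTwoSidedLevyProcess P Y) {g : ℝ → ℝ}
    (hg : ContDiff ℝ 1 g) {a b : ℝ} (hab : a ≤ b) :
    AEMeasurable (fun ω ↦ pathIntegral g (fun s ↦ Y s ω) a b) P := by
  refine aemeasurable_of_tendsto_metrizable_ae atTop
    (fun n ↦ (hY.measurable_sum_mul_sub (fun i ↦ (Set.Ico a b).indicator g (gridPoint ⌊a⌋ n i))
      (gridPoint ⌊a⌋ n) (⌈b - ⌊a⌋⌉₊ * (n + 1))).aemeasurable) ?_
  filter_upwards [hY.ae_isCadlag] with ω hω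
  exact tendsto_sum_indicator_mul_sub_pathIntegral hg hω (Int.floor_le a) hab
    (by linarith [Nat.le_ceil (b - ⌊a⌋)])

lemma aemeasurable_of_ae_tendsto_pathIntegral (hY : IsTwoSidedLevyProcess P Y) {g : ℝ → ℝ}
    (hg : ContDiff ℝ 1 g) {a : ℝ} {Z : Ω → ℝ} (hZ : ∀ᵐ ω ∂P, Tendsto
      (fun b ↦ pathIntegral g (fun s ↦ Y s ω) a b) atTop (𝓝 (Z ω))) : AEMeasurable Z P := by
  have hle (m : ℕ) : a ≤ a + m := by simp
  refine aemeasurable_of_tendsto_metrizable_ae atTop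
    (fun m ↦ hY.aemeasurable_pathIntegral hg (hle m)) ?_
  filter_upwards [hZ] with ω hω
  exact hω.comp (tendsto_atTop_add_const_left _ a tendsto_natCast_atTop_atTop)

variable [IsProbabilityMeasure P] {ψ : ℝ → ℂ}

lemma charFun_of_tendsto_sum_mul_sub (hY : IsTwoSidedLevyProcess P Y)
    (hψ : IsCharExponent (P.map (Y 1)) ψ) {h : ℝ → ℝ} {K : ℝ} (hK : ∀ s, |h s| ≤ K)
    (hright : ∀ s, ContinuousWithinAt h (Set.Ici s) s) {A : ℤ} {L : ℕ}
    (hzero : ∀ s ∉ Set.Ioo (A : ℝ) (A + L), h s = 0) {W : Ω → ℝ}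
    (hW : ∀ᵐ ω ∂P, Tendsto (fun n ↦ ∑ i ∈ Finset.range (L * (n + 1)),
      h (gridPoint A n i) * (Y (gridPoint A n (i + 1)) ω - Y (gridPoint A n i) ω))
      atTop (𝓝 (W ω))) :
    charFun (P.map W) 1 = Complex.exp (∫ s, ψ (h s)) := by
  obtain ⟨M, hM⟩ := (isCompact_Icc (a := -K) (b := K)).exists_bound_of_continuousOn
    hψ.continuous.continuousOn
  have hψzero (s : ℝ) (hs : s ∉ Set.Ioo (A : ℝ) (A + L)) : ψ (h s) = 0 := by
    rw [hzero s hs, hψ.map_zero]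
  have hsupport : Function.support (fun s ↦ ψ (h s)) ⊆ Set.Ioc A (A + L) := fun s hs ↦
    Set.Ioo_subset_Ioc_self (not_imp_comm.1 (hψzero s) hs)
  have hexponent := tendsto_sum_gridPoint_smul (Φ := fun s ↦ ψ (h s))
    (fun s ↦ hM _ (abs_le.1 (hK s)))
    (fun s ↦ hψ.continuous.continuousAt.comp_continuousWithinAt (hright s))
    (hψzero A (by simp)) (hψzero (A + L) (by simp))
  rw [intervalIntegral.integral_eq_integral_of_support_subset hsupport] at hexponent
  have hcharFun := tendsto_charFun_map_of_ae_tendsto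
    (fun n ↦ (hY.measurable_sum_mul_sub _ _ _).aemeasurable) hW 1
  simp_rw [hY.charFun_sum_mul_sub hψ (strictMono_gridPoint A _).monotone,
    ← Complex.real_smul] at hcharFun
  exact tendsto_nhds_unique hcharFun ((Complex.continuous_exp.tendsto _).comp hexponent)

theorem charFun_sum_pathIntegral (hY : IsTwoSidedLevyProcess P Y)
    (hψ : IsCharExponent (P.map (Y 1)) ψ) {ι : Type*} (I : Finset ι) {g : ι → ℝ → ℝ}
    (hg : ∀ j ∈ I, ContDiff ℝ 1 (g j)) {a b : ι → ℝ} (hab : ∀ j ∈ I, a j ≤ b j) :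
    charFun (P.map fun ω ↦ ∑ j ∈ I, pathIntegral (g j) (fun s ↦ Y s ω) (a j) (b j)) 1
      = Complex.exp (∫ s, ψ (∑ j ∈ I, (Set.Ico (a j) (b j)).indicator (g j) s)) := by
  obtain ⟨A, hA⟩ : ∃ A : ℤ, ∀ j ∈ I, (A : ℝ) < a j := by
    obtain ⟨c, hc⟩ := (I.finite_toSet.image a).bddBelow
    obtain ⟨A, hAc⟩ := exists_int_lt c
    exact ⟨A, fun j hj ↦ hAc.trans_le (hc (Set.mem_image_of_mem a hj))⟩
  obtain ⟨L, hL⟩ : ∃ L : ℕ, ∀ j ∈ I, b j ≤ A + L := by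
    obtain ⟨d, hd⟩ := (I.finite_toSet.image b).bddAbove
    obtain ⟨L, hdL⟩ := exists_nat_ge (d - A)
    exact ⟨L, fun j hj ↦ (hd (Set.mem_image_of_mem b hj)).trans (by linarith)⟩
  choose! K hK using fun j hj ↦
    exists_forall_abs_indicator_Ico_le (hg j hj).continuous (a j) (b j)
  refine hY.charFun_of_tendsto_sum_mul_sub hψ (A := A) (L := L)
    (h := fun s ↦ ∑ j ∈ I, (Set.Ico (a j) (b j)).indicator (g j) s) (K := ∑ j ∈ I, K j)
    (fun s ↦ ?_) (fun s ↦ ?_) (fun s hs ↦ ?_) ?_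
  · exact (Finset.abs_sum_le_sum_abs _ _).trans (Finset.sum_le_sum fun j hj ↦ hK j hj s)
  · exact tendsto_finsetSum I fun j hj ↦
      continuousWithinAt_Ici_indicator_Ico (hg j hj).continuous (a j) (b j) s
  · refine Finset.sum_eq_zero fun j hj ↦ Set.indicator_of_notMem (fun hs' ↦ hs ?_) _
    exact ⟨(hA j hj).trans_le hs'.1, hs'.2.trans_le (hL j hj)⟩
  · filter_upwards [hY.ae_isCadlag] with ω hω
    refine (tendsto_finsetSum I fun j hj ↦ tendsto_sum_indicator_mul_sub_pathIntegral (hg j hj) hω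
      (hA j hj).le (hab j hj) (hL j hj)).congr fun n ↦ ?_
    simp_rw [Finset.sum_mul]
    exact Finset.sum_comm

end IsTwoSidedLevyProcess

end PathIntegral

section Ottaviani

/-- The event that a process enters the complement of the ball of radius `c` at time `k` for the
first time. -/
def firstExit {Ω E : Type*} [Norm E] (S : ℕ → Ω → E) (c : ℝ) (k : ℕ) : Set Ω :=
  {ω | c < ‖S k ω‖ ∧ ∀ j < k, ‖S j ω‖ ≤ c}

lemma exists_mem_firstExit {Ω E : Type*} [Norm E] {S : ℕ → Ω → E} {c : ℝ} {ω : Ω} {k : ℕ}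
    (hk : c < ‖S k ω‖) : ∃ j ≤ k, ω ∈ firstExit S c j := by
  classical
  have hex : ∃ j, c < ‖S j ω‖ := ⟨k, hk⟩
  exact ⟨Nat.find hex, Nat.find_min' hex hk, Nat.find_spec hex,
    fun j hj ↦ not_lt.1 (Nat.find_min hex hj)⟩

lemma pairwise_disjoint_firstExit {Ω E : Type*} [Norm E] (S : ℕ → Ω → E) (c : ℝ) :
    Pairwise (Function.onFun Disjoint (firstExit S c)) := by
  refine pairwise_disjoint_on (firstExit S c) |>.2 fun j k hjk ↦ ?_
  exact Set.disjoint_left.2 fun ω hj hk ↦ (hk.2 j hjk).not_gt hj.1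

lemma measurableSet_firstExit {Ω E : Type*} [MeasurableSpace Ω] [NormedAddCommGroup E]
    [MeasurableSpace E] [BorelSpace E] {S : ℕ → Ω → E} {k : ℕ}
    (hS : ∀ j ≤ k, Measurable (S j)) (c : ℝ) : MeasurableSet (firstExit S c k) := by
  have heq : firstExit S c k = {ω | c < ‖S k ω‖} ∩ ⋂ j, ⋂ (_ : j < k), {ω | ‖S j ω‖ ≤ c} := by
    ext ω
    simp [firstExit]
  rw [heq]
  exact (measurableSet_lt measurable_const (hS k le_rfl).norm).inter <|
    MeasurableSet.iInter fun j ↦ MeasurableSet.iInter fun hj ↦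
      measurableSet_le (hS j hj.le).norm measurable_const

variable {Ω E : Type*} [MeasurableSpace Ω] {P : Measure Ω} [NormedAddCommGroup E]
  [MeasurableSpace E] [BorelSpace E] [SecondCountableTopology E] {D : ℕ → Ω → E}

lemma measure_firstExit_inter_norm_sum_Ico_le (hindep : iIndepFun D P)
    (hD : ∀ i, Measurable (D i)) (k N : ℕ) (c β : ℝ) :
    P (firstExit (fun j ω ↦ ∑ i ∈ Finset.range j, D i ω) c k ∩
        {ω | ‖∑ i ∈ Finset.Ico k N, D i ω‖ ≤ β})
      = P (firstExit (fun j ω ↦ ∑ i ∈ Finset.range j, D i ω) c k) *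
        P {ω | ‖∑ i ∈ Finset.Ico k N, D i ω‖ ≤ β} := by
  have hpast_future := indep_iSup_of_disjoint (fun i ↦ (hD i).comap_le) hindep
    (Set.Iio_disjoint_Ici (le_refl k))
  have hmeas {T : Set ℕ} {s : Finset ℕ} (hs : ∀ i ∈ s, i ∈ T) :
      Measurable[⨆ i ∈ T, MeasurableSpace.comap (D i) inferInstance] fun ω ↦ ∑ i ∈ s, D i ω :=
    Finset.measurable_fun_sum s fun i hi ↦
      (comap_measurable (D i)).mono (le_iSup₂ (f := fun i (_ : i ∈ T) ↦
        MeasurableSpace.comap (D i) inferInstance) i (hs i hi)) le_rfl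
  refine (Indep_iff _ _ _).1 hpast_future _ _ ?_ ?_
  · exact @measurableSet_firstExit _ _ (_) _ _ _ _ _ (fun j hj ↦ hmeas fun i hi ↦
      (Finset.mem_range.1 hi).trans_le hj) c
  · exact hmeas (fun i hi ↦ (Finset.mem_Ico.1 hi).1) (measurable_norm measurableSet_Iic)

/-- **Ottaviani's maximal inequality** -/
theorem measure_exists_lt_norm_sum_le (hindep : iIndepFun D P) (hD : ∀ i, Measurable (D i))
    {N : ℕ} {α β : ℝ} {C : ℝ≥0∞}
    (hβ : ∀ k ≤ N, 1 ≤ C * P {ω | ‖∑ i ∈ Finset.Ico k N, D i ω‖ ≤ β}) :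
    P {ω | ∃ k ≤ N, α + β < ‖∑ i ∈ Finset.range k, D i ω‖}
      ≤ C * P {ω | α < ‖∑ i ∈ Finset.range N, D i ω‖} := by
  set A := firstExit (fun j ω ↦ ∑ i ∈ Finset.range j, D i ω) (α + β)
  set B : ℕ → Set Ω := fun k ↦ {ω | ‖∑ i ∈ Finset.Ico k N, D i ω‖ ≤ β}
  have hsum (s : Finset ℕ) : Measurable fun ω ↦ ∑ i ∈ s, D i ω :=
    Finset.measurable_fun_sum _ fun i _ ↦ hD i
  have hA (k : ℕ) : MeasurableSet (A k) := measurableSet_firstExit (fun j _ ↦ hsum _) _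
  have hB (k : ℕ) : MeasurableSet (B k) := measurableSet_le (hsum _).norm measurable_const
  have hdisj : Pairwise (Function.onFun Disjoint fun k ↦ A k ∩ B k) :=
    (pairwise_disjoint_firstExit _ _).mono fun j k h ↦
      h.mono Set.inter_subset_left Set.inter_subset_left
  calc P {ω | ∃ k ≤ N, α + β < ‖∑ i ∈ Finset.range k, D i ω‖}
      ≤ P (⋃ k ∈ Finset.range (N + 1), A k) := by
        refine measure_mono fun ω ⟨k, hkN, hk⟩ ↦ ?_
        obtain ⟨j, hjk, hj⟩ := exists_mem_firstExit
          (S := fun j ω ↦ ∑ i ∈ Finset.range j, D i ω) hk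
        exact Set.mem_biUnion (Finset.mem_range_succ_iff.2 (hjk.trans hkN)) hj
    _ ≤ ∑ k ∈ Finset.range (N + 1), P (A k) := measure_biUnion_finset_le _ _
    _ ≤ ∑ k ∈ Finset.range (N + 1), C * P (A k ∩ B k) := by
        refine Finset.sum_le_sum fun k hk ↦ ?_
        rw [measure_firstExit_inter_norm_sum_Ico_le hindep hD, mul_left_comm]
        exact le_mul_of_one_le_right zero_le (hβ k (Finset.mem_range_succ_iff.1 hk))
    _ = C * P (⋃ k ∈ Finset.range (N + 1), A k ∩ B k) := by
        rw [← Finset.mul_sum, measure_biUnion_finset (fun j _ k _ h ↦ hdisj h)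
          fun k _ ↦ (hA k).inter (hB k)]
    _ ≤ C * P {ω | α < ‖∑ i ∈ Finset.range N, D i ω‖} := by
        gcongr
        refine Set.iUnion₂_subset fun k hk ω ⟨hωA, hωB⟩ ↦ ?_
        have hsplit := Finset.sum_range_add_sum_Ico (fun i ↦ D i ω) (Finset.mem_range_succ_iff.1 hk)
        have htriangle := norm_sub_le (∑ i ∈ Finset.range N, D i ω) (∑ i ∈ Finset.Ico k N, D i ω)
        rw [← hsplit, add_sub_cancel_right, hsplit] at htriangle
        have hlt : α + β < ‖∑ i ∈ Finset.range k, D i ω‖ := hωA.1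
        rw [Set.mem_ofPred_eq] at hωB ⊢
        linarith

end Ottaviani

section Growth

lemma exists_forall_measure_lt_norm_le {Ω ι E : Type*} [MeasurableSpace Ω] {P : Measure Ω}
    [IsFiniteMeasure P] [NormedAddCommGroup E] [MeasurableSpace E] [BorelSpace E]
    {Z : ι → Ω → E} (hZ : ∀ i, Measurable (Z i)) (hbdd : ∀ᵐ ω ∂P, ∃ M, ∀ i, ‖Z i ω‖ ≤ M)
    {ε : ℝ≥0∞} (hε : ε ≠ 0) : ∃ β, 0 ≤ β ∧ ∀ i, P {ω | β < ‖Z i ω‖} ≤ ε := by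
  by_contra! hcon
  choose i hi using fun m : ℕ ↦ hcon m m.cast_nonneg
  let C (n : ℕ) : Set Ω := ⋃ m ≥ n, {ω | (m : ℝ) < ‖Z (i m) ω‖}
  have hC (n : ℕ) : NullMeasurableSet (C n) P :=
    (MeasurableSet.iUnion fun m ↦ MeasurableSet.iUnion fun _ ↦
      measurableSet_lt measurable_const (hZ _).norm).nullMeasurableSet
  have hanti : Antitone C := fun k l hkl ↦
    Set.biUnion_subset_biUnion_left fun m (hm : l ≤ m) ↦ hkl.trans hm
  have hzero : P (⋂ n, C n) = 0 := by
    refine measure_eq_zero_iff_ae_notMem.2 ?_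
    filter_upwards [hbdd] with ω ⟨M, hM⟩ hmem
    obtain ⟨n, hn⟩ := exists_nat_ge M
    obtain ⟨m, hm, hlt⟩ := Set.mem_iUnion₂.1 (Set.mem_iInter.1 hmem n)
    have hnm : (n : ℝ) ≤ m := Nat.cast_le.2 hm
    exact ((hM (i m)).trans (hn.trans hnm)).not_gt hlt
  have hlim := tendsto_measure_iInter_atTop hC hanti ⟨0, measure_ne_top P _⟩
  rw [hzero] at hlim
  refine hε (le_zero_iff.1 (ge_of_tendsto' hlim fun n ↦ (hi n).le.trans (measure_mono ?_)))
  exact Set.subset_biUnion_of_mem (u := fun m : ℕ ↦ {ω | (m : ℝ) < ‖Z (i m) ω‖}) (le_refl n)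

variable {Ω : Type*} [MeasurableSpace Ω] {P : Measure Ω} {Y : ℝ → Ω → ℝ}

namespace IsTwoSidedLevyProcess

lemma measure_lt_abs_sub_eq (hY : IsTwoSidedLevyProcess P Y) (s t c : ℝ) :
    P {ω | c < |Y t ω - Y s ω|} = P {ω | c < |Y (t - s) ω|} := by
  have hstationary := (hY.stationary 0 (t - s) s).measure_mem_eq (s := {x | c < |x|})
    (measurableSet_lt measurable_const measurable_id.abs)
  rw [zero_add, sub_add_cancel] at hstationary
  refine hstationary.trans (measure_congr ?_)
  filter_upwards [hY.zero] with ω hω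
  change (c < |Y (t - s) ω - Y 0 ω|) = (c < |Y (t - s) ω|)
  rw [hω, sub_zero]

variable [IsProbabilityMeasure P]

lemma exists_forall_measure_lt_abs_le_half (hY : IsTwoSidedLevyProcess P Y) :
    ∃ β : ℝ, 0 ≤ β ∧ ∀ s ∈ Set.Icc (0 : ℝ) 1, P {ω | β < |Y s ω|} ≤ 2⁻¹ := by
  obtain ⟨β, hβ0, hβ⟩ := exists_forall_measure_lt_norm_le (P := P)
    (Z := fun s : Set.Icc (0 : ℝ) 1 ↦ Y s) (fun s ↦ hY.measurable s) (by
      filter_upwards [hY.ae_isCadlag] with ω hω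
      obtain ⟨M, hM⟩ := hω.exists_forall_norm_le 0 1
      exact ⟨M, fun s ↦ hM s s.2⟩) (ε := 2⁻¹) (by simp)
  exact ⟨β, hβ0, fun s hs ↦ hβ ⟨s, hs⟩⟩

lemma measure_exists_gridPoint_lt_abs_sub_le (hY : IsTwoSidedLevyProcess P Y) {β : ℝ}
    (hβ : ∀ s ∈ Set.Icc (0 : ℝ) 1, P {ω | β < |Y s ω|} ≤ 2⁻¹) (k : ℤ) (α : ℝ) (n : ℕ) :
    P {ω | ∃ i ≤ n + 1, α + β < |Y (gridPoint k n i) ω - Y k ω|} ≤ 2 * P {ω | α < |Y 1 ω|} := by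
  have hmono := (strictMono_gridPoint k n).monotone
  have hend : gridPoint k n (n + 1) = k + 1 := by simpa using gridPoint_mul_succ k n 1
  have hpast (j : ℕ) (ω : Ω) : ∑ i ∈ Finset.range j,
      (Y (gridPoint k n (i + 1)) ω - Y (gridPoint k n i) ω) = Y (gridPoint k n j) ω - Y k ω := by
    rw [Finset.sum_range_sub (fun i ↦ Y (gridPoint k n i) ω), gridPoint_zero]
  have hfuture {i : ℕ} (hi : i ≤ n + 1) (ω : Ω) : ∑ j ∈ Finset.Ico i (n + 1),
      (Y (gridPoint k n (j + 1)) ω - Y (gridPoint k n j) ω)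
      = Y (k + 1) ω - Y (gridPoint k n i) ω := by
    rw [Finset.sum_Ico_sub (fun j ↦ Y (gridPoint k n j) ω) hi, hend]
  have hottaviani := measure_exists_lt_norm_sum_le (hY.indep.nat hmono)
    (fun i ↦ hY.measurable_sub _ _) (N := n + 1) (α := α) (β := β) (C := 2) fun i hi ↦ ?_
  · simp_rw [hpast, hend, Real.norm_eq_abs, hY.measure_lt_abs_sub_eq, add_sub_cancel_left]
      at hottaviani
    exact hottaviani
  · simp_rw [hfuture hi, Real.norm_eq_abs, ← not_lt (b := |_|)]
    have hmem : k + 1 - gridPoint k n i ∈ Set.Icc (0 : ℝ) 1 := by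
      have hlower := hmono (Nat.zero_le i)
      have hupper := hmono hi
      rw [gridPoint_zero] at hlower
      rw [hend] at hupper
      exact ⟨by linarith, by linarith⟩
    have hcompl : P {ω | ¬ β < |Y (k + 1) ω - Y (gridPoint k n i) ω|}
        = 1 - P {ω | β < |Y (k + 1) ω - Y (gridPoint k n i) ω|} :=
      prob_compl_eq_one_sub (measurableSet_lt measurable_const (hY.measurable_sub _ _).abs)
    rw [hcompl, hY.measure_lt_abs_sub_eq]
    calc (1 : ℝ≥0∞) = 2 * (1 - 2⁻¹) := by
          rw [ENNReal.one_sub_inv_two, ENNReal.mul_inv_cancel (by simp) (by simp)]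
      _ ≤ _ := by gcongr; exact hβ _ hmem

lemma measure_exists_lt_abs_sub_le (hY : IsTwoSidedLevyProcess P Y) {β : ℝ}
    (hβ : ∀ s ∈ Set.Icc (0 : ℝ) 1, P {ω | β < |Y s ω|} ≤ 2⁻¹) (k : ℤ) (α : ℝ) :
    P {ω | ∃ s ∈ Set.Icc (k : ℝ) (k + 1), α + β < |Y s ω - Y k ω|}
      ≤ 2 * P {ω | α < |Y 1 ω|} := by
  let A (n : ℕ) : Set Ω := {ω | ∃ i ≤ n + 1, α + β < |Y (gridPoint k n i) ω - Y k ω|}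
  have heventually : ∀ᵐ ω ∂P, (∃ s ∈ Set.Icc (k : ℝ) (k + 1), α + β < |Y s ω - Y k ω|) →
      ω ∈ ⋃ m, ⋂ n ≥ m, A n := by
    filter_upwards [hY.ae_isCadlag] with ω hω ⟨s, hs, hlt⟩
    have hlim := ((tendsto_comp_ceilGrid (hω s).1).sub_const (Y k ω)).abs
    obtain ⟨m, hm⟩ := eventually_atTop.1 (hlim.eventually_const_lt hlt)
    refine Set.mem_iUnion.2 ⟨m, Set.mem_iInter₂.2 fun n hn ↦ ?_⟩
    obtain ⟨i, hi, hle⟩ := exists_gridPoint_eq_ceilGrid n hs.1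
    have hend : gridPoint k n (n + 1) = k + 1 := by simpa using gridPoint_mul_succ k n 1
    exact ⟨i, (hle _).1 (hs.2.trans_eq hend.symm), by rw [hi]; exact hm n hn⟩
  have hmono : Monotone fun m ↦ ⋂ n ≥ m, A n := fun i j hij ↦
    Set.biInter_subset_biInter_left fun n (hn : j ≤ n) ↦ hij.trans hn
  calc P {ω | ∃ s ∈ Set.Icc (k : ℝ) (k + 1), α + β < |Y s ω - Y k ω|}
      ≤ P (⋃ m, ⋂ n ≥ m, A n) := measure_mono_ae heventually
    _ = ⨆ m, P (⋂ n ≥ m, A n) := hmono.measure_iUnion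
    _ ≤ 2 * P {ω | α < |Y 1 ω|} := iSup_le fun m ↦
        (measure_mono (Set.biInter_subset_of_mem (le_refl m))).trans
          (hY.measure_exists_gridPoint_lt_abs_sub_le hβ k α m)

end IsTwoSidedLevyProcess

lemma abs_le_mul_exp_of_abs_sub_le {y : ℕ → ℝ} {θ β : ℝ} (hθ : 0 < θ) (hβ : 0 ≤ β) {K : ℕ}
    (hy : ∀ k, K ≤ k → |y (k + 1) - y k| ≤ Real.exp (θ * k) + β) {k : ℕ} (hk : K ≤ k) :
    |y k| ≤ max |y K| ((1 + β) / θ) * Real.exp (θ * k) := by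
  set C := max |y K| ((1 + β) / θ)
  have hexp (k : ℕ) : 1 ≤ Real.exp (θ * k) := Real.one_le_exp (by positivity)
  induction k, hk using Nat.le_induction with
  | base => exact (le_max_left _ _).trans (le_mul_of_one_le_right (by positivity) (hexp K))
  | succ k hk ih =>
    have hCθ : 1 + β ≤ C * θ := (div_le_iff₀ hθ).1 (le_max_right _ _)
    calc |y (k + 1)| = |(y (k + 1) - y k) + y k| := by rw [sub_add_cancel]
      _ ≤ (Real.exp (θ * k) + β) + C * Real.exp (θ * k) :=
        (abs_add_le _ _).trans (add_le_add (hy k hk) ih)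
      _ ≤ C * (Real.exp (θ * k) * (θ + 1)) := by nlinarith [hexp k]
      _ ≤ C * (Real.exp (θ * k) * Real.exp θ) := by
        gcongr
        exact Real.add_one_le_exp θ
      _ = C * Real.exp (θ * (k + 1 : ℕ)) := by
        rw [← Real.exp_add]
        push_cast
        ring_nf

lemma isBigO_exp_of_forall_abs_sub_le {y : ℝ → ℝ} {θ β : ℝ} (hθ : 0 < θ) (hβ : 0 ≤ β) {K : ℕ}
    (hy : ∀ k : ℕ, K ≤ k → ∀ s ∈ Set.Icc (k : ℝ) (k + 1),
      |y s - y k| ≤ Real.exp (θ * k) + β) :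
    y =O[atTop] fun s ↦ Real.exp (θ * s) := by
  have hstep (k : ℕ) (hk : K ≤ k) : |y (k + 1 : ℕ) - y k| ≤ Real.exp (θ * k) + β := by
    push_cast
    exact hy k hk _ ⟨by linarith, le_rfl⟩
  refine Asymptotics.IsBigO.of_bound (1 + β + max |y K| ((1 + β) / θ)) ?_
  filter_upwards [eventually_ge_atTop (K : ℝ)] with s hs
  have hs0 : 0 ≤ s := K.cast_nonneg.trans hs
  have hinteger := abs_le_mul_exp_of_abs_sub_le (y := fun k ↦ y k) hθ hβ hstep (Nat.le_floor hs)
  have hbetween := hy _ (Nat.le_floor hs) s ⟨Nat.floor_le hs0, (Nat.lt_floor_add_one s).le⟩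
  have hexp : 1 ≤ Real.exp (θ * ⌊s⌋₊) := Real.one_le_exp (by positivity)
  calc ‖y s‖ = |(y s - y ⌊s⌋₊) + y ⌊s⌋₊| := by rw [sub_add_cancel, Real.norm_eq_abs]
    _ ≤ (Real.exp (θ * ⌊s⌋₊) + β) + max |y K| ((1 + β) / θ) * Real.exp (θ * ⌊s⌋₊) :=
      (abs_add_le _ _).trans (add_le_add hbetween hinteger)
    _ ≤ (1 + β + max |y K| ((1 + β) / θ)) * Real.exp (θ * ⌊s⌋₊) := by nlinarith
    _ ≤ (1 + β + max |y K| ((1 + β) / θ)) * ‖Real.exp (θ * s)‖ := by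
      rw [Real.norm_eq_abs, Real.abs_exp]
      gcongr
      exact Nat.floor_le hs0

theorem IsTwoSidedLevyProcess.ae_isBigO_exp [IsProbabilityMeasure P]
    (hY : IsTwoSidedLevyProcess P Y) (hlog : Integrable (fun ω ↦ Real.posLog |Y 1 ω|) P)
    {θ : ℝ} (hθ : 0 < θ) :
    ∀ᵐ ω ∂P, (fun s ↦ Y s ω) =O[atTop] fun s ↦ Real.exp (θ * s) := by
  obtain ⟨β, hβ0, hβ⟩ := hY.exists_forall_measure_lt_abs_le_half
  let F (k : ℕ) : Set Ω :=
    {ω | ∃ s ∈ Set.Icc (k : ℝ) (k + 1), Real.exp (θ * k) + β < |Y s ω - Y k ω|}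
  have hF (k : ℕ) : P (F k) ≤ 2 * P {ω | θ⁻¹ * Real.posLog |Y 1 ω| ∈ Set.Ioi (k : ℝ)} := by
    refine (hY.measure_exists_lt_abs_sub_le hβ k (Real.exp (θ * k))).trans ?_
    gcongr with ω
    rintro (hω : Real.exp (θ * k) < |Y 1 ω|)
    have hlog_lt := (Real.lt_log_iff_exp_lt ((Real.exp_pos _).trans hω)).2 hω
    exact (lt_inv_mul_iff₀ hθ).2 (hlog_lt.trans_le (le_max_right _ _))
  have hsummable : ∑' k, P (F k) ≠ ∞ := by
    refine ((ENNReal.tsum_le_tsum hF).trans_lt ?_).ne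
    rw [ENNReal.tsum_mul_left]
    exact ENNReal.mul_lt_top (by simp) <|
      @tsum_prob_mem_Ioi_lt_top Ω ⟨P⟩ ‹_› _ (hlog.const_mul θ⁻¹) fun ω ↦
        mul_nonneg (by positivity) Real.posLog_nonneg
  filter_upwards [ae_eventually_notMem hsummable] with ω hω
  obtain ⟨K, hK⟩ := eventually_atTop.1 hω
  refine isBigO_exp_of_forall_abs_sub_le hθ hβ0 (K := K) fun k hk s hs ↦ ?_
  by_contra! hlt
  exact hK k hk ⟨s, hs, hlt⟩

lemma IsCadlag.locallyIntegrable {E : Type*} [NormedAddCommGroup E] [MeasurableSpace E]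
    [BorelSpace E] [SecondCountableTopology E] {y : ℝ → E} (hy : IsCadlag y) :
    LocallyIntegrable y := by
  have hmeas : Measurable y := measurable_of_continuousWithinAt_Ici fun s ↦ (hy s).1
  refine locallyIntegrable_iff.2 fun k hk ↦ ?_
  obtain ⟨M, hM⟩ := hy.exists_forall_norm_le (sInf k) (sSup k)
  exact IntegrableOn.of_bound hk.measure_lt_top hmeas.aestronglyMeasurable M <|
    ae_restrict_of_forall_mem hk.measurableSet fun s hs ↦
      hM s ⟨csInf_le hk.bddBelow hs, le_csSup hk.bddAbove hs⟩

lemma exists_tendsto_pathIntegral_exp_neg {y : ℝ → ℝ} (hy : IsCadlag y) {θ : ℝ} (hθ : θ < 1)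
    (hgrowth : y =O[atTop] fun s ↦ Real.exp (θ * s)) (a : ℝ) :
    ∃ l, Tendsto (fun b ↦ pathIntegral (fun s ↦ Real.exp (-s)) y a b) atTop (𝓝 l) := by
  have hdecay : (fun s ↦ Real.exp (-s) * y s) =O[atTop] fun s ↦ Real.exp (-(1 - θ) * s) :=
    ((Asymptotics.isBigO_refl _ _).mul hgrowth).congr_right fun s ↦ by
      rw [← Real.exp_add]
      ring_nf
  have hboundary : Tendsto (fun b ↦ Real.exp (-b) * y b) atTop (𝓝 0) :=
    hdecay.trans_tendsto <| Real.tendsto_exp_atBot.comp <|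
      tendsto_id.const_mul_atTop_of_neg (by linarith)
  have hintegrable : IntegrableOn (fun s ↦ y s * -Real.exp (-s)) (Set.Ioi a) := by
    have hlocal : LocallyIntegrableOn (fun s ↦ y s * -Real.exp (-s)) (Set.Ici a) :=
      (hy.locallyIntegrable.locallyIntegrableOn _).mul_continuousOn (by fun_prop)
        isClosed_Ici.isLocallyClosed
    refine (hlocal.integrableOn_of_isBigO_atTop (hdecay.neg_left.congr_left fun s ↦ by ring)
      ⟨Set.Ioi 0, Ioi_mem_atTop 0, ?_⟩).mono_set Set.Ioi_subset_Ici_self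
    exact integrableOn_exp_mul_Ioi (by linarith) 0
  simp_rw [pathIntegral, deriv_comp_neg Real.exp, Real.deriv_exp]
  exact ⟨_, (hboundary.sub_const _).sub
    (intervalIntegral_tendsto_integral_Ioi a hintegrable tendsto_id)⟩

end Growth

section CosineAverage

lemma mul_sq_le_integral_one_sub_cos {y δ : ℝ} (hδ : 0 ≤ δ) (hy : |y| * δ ≤ Real.pi) :
    2 / Real.pi ^ 2 * (δ ^ 3 / 3) * y ^ 2 ≤ ∫ u in (0 : ℝ)..δ, (1 - Real.cos (y * u)) := by
  calc 2 / Real.pi ^ 2 * (δ ^ 3 / 3) * y ^ 2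
      = ∫ u in (0 : ℝ)..δ, 2 / Real.pi ^ 2 * y ^ 2 * u ^ 2 := by
        rw [intervalIntegral.integral_const_mul, integral_pow]
        ring
    _ ≤ ∫ u in (0 : ℝ)..δ, (1 - Real.cos (y * u)) := by
        refine intervalIntegral.integral_mono_on hδ
          (Continuous.intervalIntegrable (by fun_prop) _ _)
          (Continuous.intervalIntegrable (by fun_prop) _ _) fun u hu ↦ ?_
        have hyu : |y * u| ≤ Real.pi := by
          rw [abs_mul, abs_of_nonneg hu.1]
          exact (mul_le_mul_of_nonneg_left hu.2 (abs_nonneg y)).trans hy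
        linarith [Real.cos_le_one_sub_mul_cos_sq hyu, mul_pow y u 2]

lemma half_le_integral_one_sub_cos {y δ : ℝ} (hδ : 0 < δ) (hy : 2 ≤ |y| * δ) :
    δ / 2 ≤ ∫ u in (0 : ℝ)..δ, (1 - Real.cos (y * u)) := by
  have hy_pos : 0 < |y| := pos_of_mul_pos_left (two_pos.trans_le hy) hδ.le
  have hintegral : ∫ u in (0 : ℝ)..δ, (1 - Real.cos (y * u)) = δ - y⁻¹ * Real.sin (y * δ) := by
    rw [intervalIntegral.integral_sub intervalIntegrable_const
      (Continuous.intervalIntegrable (by fun_prop) _ _),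
      intervalIntegral.integral_comp_mul_left Real.cos (abs_pos.1 hy_pos)]
    simp
  have hsin : y⁻¹ * Real.sin (y * δ) ≤ δ / 2 :=
    calc y⁻¹ * Real.sin (y * δ) ≤ |y|⁻¹ * |Real.sin (y * δ)| := by
          rw [← abs_inv, ← abs_mul]
          exact le_abs_self _
      _ ≤ |y|⁻¹ * 1 := by gcongr; exact Real.abs_sin_le_one _
      _ ≤ δ / 2 := by
          rw [mul_one, inv_le_comm₀ hy_pos (by positivity), inv_div, div_le_iff₀ hδ]
          exact hy
  linarith

lemma exists_mul_min_le_integral_one_sub_cos {δ : ℝ} (hδ : 0 < δ) :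
    ∃ c > 0, ∀ y : ℝ, c * min 1 (y ^ 2) ≤ ∫ u in (0 : ℝ)..δ, (1 - Real.cos (y * u)) := by
  refine ⟨min (2 / Real.pi ^ 2 * (δ ^ 3 / 3)) (δ / 2), by positivity, fun y ↦ ?_⟩
  rcases le_total (|y| * δ) 2 with hsmall | hlarge
  · exact (mul_le_mul (min_le_left _ _) (min_le_right _ _) (by positivity) (by positivity)).trans
      (mul_sq_le_integral_one_sub_cos hδ.le (by linarith [Real.pi_gt_three]))
  · exact (mul_le_mul (min_le_right _ _) (min_le_left _ _) (by positivity) (by positivity)).trans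
      (by simpa using half_le_integral_one_sub_cos hδ hlarge)

lemma integrable_min_one_sq_of_lintegral_one_sub_cos_le {α : Type*} [MeasurableSpace α]
    {m : Measure α} [SFinite m] {f : α → ℝ} (hf : Measurable f) {δ : ℝ} (hδ : 0 < δ) {c : ℝ≥0∞}
    (hc : c ≠ ∞) (hcos : ∀ u ∈ Set.Ioc 0 δ, ∫⁻ a, .ofReal (1 - Real.cos (f a * u)) ∂m ≤ c) :
    Integrable (fun a ↦ min 1 (f a ^ 2)) m := by
  obtain ⟨ε, hε, hle⟩ := exists_mul_min_le_integral_one_sub_cos hδ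
  have hfinite : ∫⁻ a, .ofReal (ε * min 1 (f a ^ 2)) ∂m < ∞ :=
    calc ∫⁻ a, .ofReal (ε * min 1 (f a ^ 2)) ∂m
        ≤ ∫⁻ a, (∫⁻ u in Set.Ioc 0 δ, .ofReal (1 - Real.cos (f a * u))) ∂m := by
          refine lintegral_mono fun a ↦ ?_
          rw [← ofReal_integral_eq_lintegral_ofReal, ← intervalIntegral.integral_of_le hδ.le]
          · exact ENNReal.ofReal_le_ofReal (hle _)
          · exact (Continuous.integrableOn_Icc (by fun_prop)).mono_set Set.Ioc_subset_Icc_self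
          · exact Eventually.of_forall fun _ ↦ sub_nonneg.2 (Real.cos_le_one _)
      _ = ∫⁻ u in Set.Ioc 0 δ, ∫⁻ a, .ofReal (1 - Real.cos (f a * u)) ∂m :=
          lintegral_lintegral_swap (Measurable.aemeasurable (by fun_prop))
      _ ≤ ∫⁻ _ in Set.Ioc 0 δ, c := setLIntegral_mono measurable_const hcos
      _ < ∞ := by
          rw [setLIntegral_const]
          exact ENNReal.mul_lt_top hc.lt_top (by simp)
  have hscaled : Integrable (fun a ↦ ε * min 1 (f a ^ 2)) m :=
    ⟨Measurable.aestronglyMeasurable (by fun_prop), by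
      rwa [hasFiniteIntegral_iff_ofReal (Eventually.of_forall fun a ↦ by positivity)]⟩
  simpa [← mul_assoc, inv_mul_cancel₀ hε.ne'] using hscaled.const_mul ε⁻¹

end CosineAverage

section JumpIntegrability

lemma re_levyKernel {E : Type*} [NormedAddCommGroup E] [InnerProductSpace ℝ E] (x u : E) :
    (levyKernel x u).re = -(1 - Real.cos (inner ℝ x u)) := by
  unfold levyKernel
  split_ifs <;> simp [Complex.exp_ofReal_mul_I_re]

lemma lintegral_one_sub_cos_le_neg_re_levyExponent {E : Type*} [NormedAddCommGroup E]
    [InnerProductSpace ℝ E] [MeasurableSpace E] [BorelSpace E] [SecondCountableTopology E]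
    {ρ : Measure E} (hρ : Integrable (fun x ↦ min 1 (‖x‖ ^ 2)) ρ) (b : E)
    {S : E →L[ℝ] E} (hS : S.IsPositive) (u : E) :
    ∫⁻ x, .ofReal (1 - Real.cos (inner ℝ x u)) ∂ρ ≤ .ofReal (-(levyExponent b S ρ u).re) := by
  have hkernel := integrable_levyKernel hρ u
  have hcos : Integrable (fun x ↦ 1 - Real.cos (inner ℝ x u)) ρ :=
    hkernel.re.neg.congr (Eventually.of_forall fun x ↦ neg_eq_iff_eq_neg.2 (re_levyKernel x u))
  have hre : (∫ x, levyKernel x u ∂ρ).re = -∫ x, (1 - Real.cos (inner ℝ x u)) ∂ρ := by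
    rw [← integral_neg]
    exact (integral_re hkernel).symm.trans
      (integral_congr_ae (Eventually.of_forall fun x ↦ re_levyKernel x u))
  rw [← ofReal_integral_eq_lintegral_ofReal hcos
    (Eventually.of_forall fun x ↦ sub_nonneg.2 (Real.cos_le_one _))]
  refine ENNReal.ofReal_le_ofReal ?_
  rw [levyExponent, Complex.add_re, Complex.sub_re, Complex.re_ofReal_mul, Complex.I_re, hre,
    Complex.div_ofNat_re, Complex.ofReal_re]
  linarith [hS.inner_nonneg_left u]

lemma IsCharExponent.re_nonpos {E : Type*} [NormedAddCommGroup E] [InnerProductSpace ℝ E]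
    [MeasurableSpace E] {μ : Measure E} [IsProbabilityMeasure μ] {ψ : E → ℂ}
    (hψ : IsCharExponent μ ψ) (u : E) : (ψ u).re ≤ 0 := by
  rw [← Real.exp_le_one_iff, ← Complex.norm_exp, ← hψ.charFun_eq_exp]
  exact norm_charFun_le_one u

lemma tendsto_setLIntegral_Ico_add_natCast (a : ℝ) (f : ℝ → ℝ≥0∞) :
    Tendsto (fun m : ℕ ↦ ∫⁻ s in Set.Ico a (a + m), f s) atTop (𝓝 (∫⁻ s in Set.Ici a, f s)) := by
  have hmono : Monotone fun m : ℕ ↦ Set.Ico a (a + m) := fun i j hij ↦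
    Set.Ico_subset_Ico_right (by gcongr)
  have hunion : ⋃ m : ℕ, Set.Ico a (a + m) = Set.Ici a := by
    ext s
    simp only [Set.mem_Ici, Set.mem_iUnion, Set.mem_Ico]
    refine ⟨fun ⟨_, hs, _⟩ ↦ hs, fun hs ↦ ?_⟩
    obtain ⟨m, hm⟩ := exists_nat_gt (s - a)
    exact ⟨m, hs, by linarith⟩
  rw [← hunion, setLIntegral_iUnion_of_directed _ hmono.directed_le]
  exact tendsto_atTop_iSup fun i j hij ↦ lintegral_mono_set (hmono hij)

namespace IsTwoSidedLevyProcess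

variable {Ω : Type*} [MeasurableSpace Ω] {P : Measure Ω} [IsProbabilityMeasure P]
  {Y : ℝ → Ω → ℝ} {ρ : Measure ℝ} {β : ℝ} {S : ℝ →L[ℝ] ℝ} {g : ℝ → ℝ}

lemma charFun_pathIntegral (hY : IsTwoSidedLevyProcess P Y) {ψ : ℝ → ℂ}
    (hψ : IsCharExponent (P.map (Y 1)) ψ) (hg : ContDiff ℝ 1 g) {a b : ℝ} (hab : a ≤ b) (u : ℝ) :
    charFun (P.map fun ω ↦ pathIntegral g (fun s ↦ Y s ω) a b) u
      = Complex.exp (∫ s in Set.Ico a b, ψ (u * g s)) := by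
  have hscaled := hY.charFun_sum_pathIntegral hψ {()} (g := fun _ s ↦ u * g s)
    (a := fun _ ↦ a) (b := fun _ ↦ b) (fun _ _ ↦ contDiff_const.mul hg) (fun _ _ ↦ hab)
  simp only [Finset.sum_singleton, pathIntegral_const_mul] at hscaled
  have hmul := charFun_map_mul_comp (hY.aemeasurable_pathIntegral hg hab) u 1
  rw [mul_one] at hmul
  rw [← hmul, hscaled, ← integral_indicator measurableSet_Ico]
  congr 2 with s
  by_cases hs : s ∈ Set.Ico a b <;> simp [hs, hψ.map_zero]

lemma lintegral_one_sub_cos_le_neg_log_norm_charFun (hY : IsTwoSidedLevyProcess P Y)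
    (hρ : Integrable (fun x ↦ min 1 (‖x‖ ^ 2)) ρ) (hS : S.IsPositive)
    (hψ : IsCharExponent (P.map (Y 1)) (levyExponent β S ρ)) (hg : ContDiff ℝ 1 g) {a b : ℝ}
    (hab : a ≤ b) (u : ℝ) :
    ∫⁻ s in Set.Ico a b, ∫⁻ x, .ofReal (1 - Real.cos (x * g s * u)) ∂ρ
      ≤ .ofReal (-Real.log ‖charFun (P.map fun ω ↦ pathIntegral g (fun s ↦ Y s ω) a b) u‖) := by
  have := Measure.isProbabilityMeasure_map (μ := P) (hY.measurable 1).aemeasurable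
  have hintegrable : IntegrableOn (fun s ↦ levyExponent β S ρ (u * g s)) (Set.Ico a b) :=
    (hψ.continuous.comp (continuous_const.mul hg.continuous)).integrableOn_Icc.mono_set
      Set.Ico_subset_Icc_self
  have hre : (∫ s in Set.Ico a b, levyExponent β S ρ (u * g s)).re
      = ∫ s in Set.Ico a b, (levyExponent β S ρ (u * g s)).re := (integral_re hintegrable).symm
  have hneg : Integrable (fun s ↦ -(levyExponent β S ρ (u * g s)).re)
      (volume.restrict (Set.Ico a b)) := hintegrable.re.neg
  rw [hY.charFun_pathIntegral hψ hg hab, Complex.norm_exp, Real.log_exp, hre, ← integral_neg,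
    ofReal_integral_eq_lintegral_ofReal hneg
      (Eventually.of_forall fun s ↦ neg_nonneg.2 (hψ.re_nonpos _))]
  refine lintegral_mono fun s ↦ ?_
  have hinner (x : ℝ) : x * g s * u = inner ℝ x (u * g s) := by
    rw [RCLike.inner_apply, conj_trivial]
    ring
  simp_rw [hinner]
  exact lintegral_one_sub_cos_le_neg_re_levyExponent hρ β hS _

lemma lintegral_Ici_one_sub_cos_le_neg_log_norm_charFun (hY : IsTwoSidedLevyProcess P Y)
    (hρ : Integrable (fun x ↦ min 1 (‖x‖ ^ 2)) ρ) (hS : S.IsPositive)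
    (hψ : IsCharExponent (P.map (Y 1)) (levyExponent β S ρ)) (hg : ContDiff ℝ 1 g) {a : ℝ}
    {Z : Ω → ℝ} (hZ : ∀ᵐ ω ∂P, Tendsto (fun b ↦ pathIntegral g (fun s ↦ Y s ω) a b) atTop
      (𝓝 (Z ω))) {u : ℝ} (hu : charFun (P.map Z) u ≠ 0) :
    ∫⁻ s in Set.Ici a, ∫⁻ x, .ofReal (1 - Real.cos (x * g s * u)) ∂ρ
      ≤ .ofReal (-Real.log ‖charFun (P.map Z) u‖) := by
  have hle (m : ℕ) : a ≤ a + m := by simp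
  have hseq : ∀ᵐ ω ∂P, Tendsto (fun m : ℕ ↦ pathIntegral g (fun s ↦ Y s ω) a (a + m)) atTop
      (𝓝 (Z ω)) := by
    filter_upwards [hZ] with ω hω
    exact hω.comp (tendsto_atTop_add_const_left _ a tendsto_natCast_atTop_atTop)
  have hcharFun := tendsto_charFun_map_of_ae_tendsto
    (fun m ↦ hY.aemeasurable_pathIntegral hg (hle m)) hseq u
  refine le_of_tendsto_of_tendsto' (tendsto_setLIntegral_Ico_add_natCast a _)
    (ENNReal.tendsto_ofReal (hcharFun.norm.log (norm_ne_zero_iff.2 hu)).neg) fun m ↦ ?_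
  exact hY.lintegral_one_sub_cos_le_neg_log_norm_charFun hρ hS hψ hg (hle m) u

theorem integrable_min_one_sq_mul_indicator_Ici (hY : IsTwoSidedLevyProcess P Y) [SFinite ρ]
    (hρ : Integrable (fun x ↦ min 1 (‖x‖ ^ 2)) ρ) (hS : S.IsPositive)
    (hψ : IsCharExponent (P.map (Y 1)) (levyExponent β S ρ)) (hg : ContDiff ℝ 1 g) {a : ℝ}
    {Z : Ω → ℝ} (hZ : ∀ᵐ ω ∂P, Tendsto (fun b ↦ pathIntegral g (fun s ↦ Y s ω) a b) atTop
      (𝓝 (Z ω))) :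
    Integrable (fun p : ℝ × ℝ ↦ min 1 ((p.2 * (Set.Ici a).indicator g p.1) ^ 2))
      (volume.prod ρ) := by
  have := Measure.isProbabilityMeasure_map (hY.aemeasurable_of_ae_tendsto_pathIntegral hg hZ)
  obtain ⟨δ, hδ, hball⟩ : ∃ δ > 0, ∀ u ∈ Set.Ioc 0 δ, 2⁻¹ < ‖charFun (P.map Z) u‖ := by
    have hnear : ∀ᶠ u in 𝓝 0, 2⁻¹ < ‖charFun (P.map Z) u‖ :=
      continuous_charFun.norm.continuousAt.eventually_const_lt (by norm_num)
    obtain ⟨δ, hδ, hsub⟩ := Metric.eventually_nhds_iff.1 hnear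
    refine ⟨δ / 2, by positivity, fun u hu ↦ hsub ?_⟩
    rw [dist_zero_right, Real.norm_of_nonneg hu.1.le]
    linarith [hu.2]
  have hind : Measurable ((Set.Ici a).indicator g) :=
    hg.continuous.measurable.indicator measurableSet_Ici
  refine integrable_min_one_sq_of_lintegral_one_sub_cos_le (c := .ofReal (Real.log 2))
    (by fun_prop) hδ ENNReal.ofReal_ne_top fun u hu ↦ ?_
  have hnorm := hball u hu
  calc ∫⁻ p : ℝ × ℝ, .ofReal (1 - Real.cos (p.2 * (Set.Ici a).indicator g p.1 * u))
        ∂(volume.prod ρ)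
      = ∫⁻ s in Set.Ici a, ∫⁻ x, .ofReal (1 - Real.cos (x * g s * u)) ∂ρ := by
        rw [lintegral_prod _ (Measurable.aemeasurable (by fun_prop)),
          ← lintegral_indicator measurableSet_Ici]
        refine lintegral_congr fun s ↦ ?_
        by_cases hs : s ∈ Set.Ici a <;> simp [hs]
    _ ≤ .ofReal (-Real.log ‖charFun (P.map Z) u‖) :=
        hY.lintegral_Ici_one_sub_cos_le_neg_log_norm_charFun hρ hS hψ hg hZ
          (norm_pos_iff.1 (by linarith))
    _ ≤ .ofReal (Real.log 2) := by
        refine ENNReal.ofReal_le_ofReal (neg_le.1 ?_)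
        rw [← Real.log_inv]
        exact Real.log_le_log (by norm_num) hnorm.le

end IsTwoSidedLevyProcess

end JumpIntegrability

section SecondMomentOperator

variable {α E : Type*} [MeasurableSpace α] {m : Measure α} [NormedAddCommGroup E]
  [InnerProductSpace ℝ E] {f : α → E}

/-- The second moment operator `x ↦ ∫ ⟪f a, x⟫ f a ∂m` of a square integrable function. -/
noncomputable def secondMomentOperator (m : Measure α) (f : α → E) : E →L[ℝ] E :=
  ∫ a, InnerProductSpace.rankOne ℝ (f a) (f a) ∂m

lemma integrable_rankOne_self (hf : MemLp f 2 m) :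
    Integrable (fun a ↦ InnerProductSpace.rankOne ℝ (f a) (f a)) m := by
  have hcont : Continuous fun y : E ↦ InnerProductSpace.rankOne ℝ y y :=
    (InnerProductSpace.rankOne ℝ (E := E) (F := E)).continuous₂.comp
      (continuous_id.prodMk continuous_id)
  refine hf.norm.integrable_sq.mono' (hcont.comp_aestronglyMeasurable hf.1)
    (Eventually.of_forall fun a ↦ ?_)
  rw [InnerProductSpace.norm_rankOne, sq]

variable [CompleteSpace E]

lemma inner_secondMomentOperator (hf : MemLp f 2 m) (x y : E) :
    inner ℝ (secondMomentOperator m f x) y = ∫ a, inner ℝ (f a) x * inner ℝ (f a) y ∂m := by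
  have hintegrable := integrable_rankOne_self hf
  rw [secondMomentOperator, ContinuousLinearMap.integral_apply hintegrable, real_inner_comm,
    ← integral_inner (hintegrable.apply_continuousLinearMap x)]
  refine integral_congr_ae (Eventually.of_forall fun a ↦ ?_)
  simp only [InnerProductSpace.rankOne_apply, real_inner_smul_right]
  rw [real_inner_comm (f a) y]

lemma isPositive_secondMomentOperator (hf : MemLp f 2 m) :
    (secondMomentOperator m f).IsPositive := by
  rw [ContinuousLinearMap.isPositive_iff]
  refine ⟨fun x y ↦ ?_, fun x ↦ ?_⟩
  · rw [ContinuousLinearMap.coe_coe, inner_secondMomentOperator hf, real_inner_comm,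
      inner_secondMomentOperator hf]
    simp_rw [mul_comm]
  · rw [inner_secondMomentOperator hf]
    exact integral_nonneg fun a ↦ mul_self_nonneg _

end SecondMomentOperator

section IntegratedExponent

lemma integral_inner_const {α E : Type*} [MeasurableSpace α] {m : Measure α}
    [NormedAddCommGroup E] [InnerProductSpace ℝ E] [CompleteSpace E] {f : α → E}
    (hf : Integrable f m) (u : E) : ∫ a, inner ℝ (f a) u ∂m = inner ℝ (∫ a, f a ∂m) u := by
  rw [real_inner_comm, ← integral_inner hf]
  simp_rw [real_inner_comm u]

lemma inner_map_self_eq_mul_sq (S : ℝ →L[ℝ] ℝ) (v : ℝ) : inner ℝ (S v) v = S 1 * v ^ 2 := by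
  have hmap : S v = v * S 1 := by rw [← smul_eq_mul, ← map_smul, smul_eq_mul, mul_one]
  rw [hmap, RCLike.inner_apply, conj_trivial]
  ring

variable {E : Type*} [NormedAddCommGroup E] [InnerProductSpace ℝ E]

/-- The discrepancy between compensating the jump `x • y` according to its own size and according
to the size of `x`. -/
noncomputable def truncationDifference (x : ℝ) (y : E) : E :=
  (if ‖x • y‖ ≤ 1 then x • y else 0) - if ‖x‖ ≤ 1 then x • y else 0

lemma levyKernel_inner_eq (x : ℝ) (y u : E) :
    levyKernel x (inner ℝ y u) = levyKernel (x • y) u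
      + (inner ℝ (truncationDifference x y) u : ℝ) * Complex.I := by
  have hinner : inner ℝ x (inner ℝ y u) = inner ℝ (x • y) u := by
    rw [real_inner_smul_left, RCLike.inner_apply, conj_trivial, mul_comm]
  unfold levyKernel truncationDifference
  rw [hinner, inner_sub_left]
  split_ifs <;> simp [sub_eq_add_neg]

variable [MeasurableSpace E]

lemma setIntegral_compl_zero_levyKernel (μ : Measure E) (u : E) :
    ∫ y in {0}ᶜ, levyKernel y u ∂μ = ∫ y, levyKernel y u ∂μ := by
  refine setIntegral_eq_integral_of_forall_compl_eq_zero fun y hy ↦ ?_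
  rw [Set.notMem_compl_iff.1 hy]
  simp [levyKernel]

variable [BorelSpace E] [SecondCountableTopology E] {α : Type*} [MeasurableSpace α]
  {m : Measure α} {ρ : Measure ℝ} {f : α → E}

lemma integrable_levyKernel_smul (hf : Measurable f)
    (hjump : Integrable (fun p : α × ℝ ↦ min 1 (‖p.2 • f p.1‖ ^ 2)) (m.prod ρ)) (u : E) :
    Integrable (fun p : α × ℝ ↦ levyKernel (p.2 • f p.1) u) (m.prod ρ) :=
  (hjump.const_mul _).mono' (Measurable.aestronglyMeasurable (by fun_prop))
    (Eventually.of_forall fun _ ↦ norm_levyKernel_le _ u)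

lemma integrable_levyKernel_inner (hf : Measurable f)
    (hjump : Integrable (fun p : α × ℝ ↦ min 1 (‖p.2 • f p.1‖ ^ 2)) (m.prod ρ))
    (htrunc : Integrable (fun p : α × ℝ ↦ truncationDifference p.2 (f p.1)) (m.prod ρ)) (u : E) :
    Integrable (fun p : α × ℝ ↦ levyKernel p.2 (inner ℝ (f p.1) u)) (m.prod ρ) := by
  simp_rw [levyKernel_inner_eq]
  exact (integrable_levyKernel_smul hf hjump u).add
    ((htrunc.inner_const u).ofReal.mul_const Complex.I)

variable [CompleteSpace E]

lemma integral_levyKernel_inner (hf : Measurable f)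
    (hjump : Integrable (fun p : α × ℝ ↦ min 1 (‖p.2 • f p.1‖ ^ 2)) (m.prod ρ))
    (htrunc : Integrable (fun p : α × ℝ ↦ truncationDifference p.2 (f p.1)) (m.prod ρ)) (u : E) :
    ∫ p : α × ℝ, levyKernel p.2 (inner ℝ (f p.1) u) ∂(m.prod ρ)
      = ∫ y, levyKernel y u ∂((m.prod ρ).map fun p ↦ p.2 • f p.1)
        + (inner ℝ (∫ p, truncationDifference p.2 (f p.1) ∂(m.prod ρ)) u : ℝ) * Complex.I := by
  have hmap : Measurable fun p : α × ℝ ↦ p.2 • f p.1 := by fun_prop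
  have hcorrection : Integrable (fun p : α × ℝ ↦
      ((inner ℝ (truncationDifference p.2 (f p.1)) u : ℝ) : ℂ) * Complex.I) (m.prod ρ) :=
    (htrunc.inner_const u).ofReal.mul_const Complex.I
  simp_rw [levyKernel_inner_eq]
  rw [integral_add (integrable_levyKernel_smul hf hjump u) hcorrection,
    integral_map hmap.aemeasurable (Measurable.aestronglyMeasurable (by fun_prop)),
    integral_mul_const, integral_complex_ofReal, integral_inner_const htrunc]

theorem exists_integral_levyExponent_inner_eq [SFinite m] [SFinite ρ] (β : ℝ) {S : ℝ →L[ℝ] ℝ}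
    (hS : S.IsPositive) (hf : Measurable f) (hf_int : Integrable f m) (hf_sq : MemLp f 2 m)
    (hjump : Integrable (fun p : α × ℝ ↦ min 1 (‖p.2 • f p.1‖ ^ 2)) (m.prod ρ))
    (htrunc : Integrable (fun p : α × ℝ ↦ truncationDifference p.2 (f p.1)) (m.prod ρ)) :
    ∃ (b : E) (T : E →L[ℝ] E), T.IsPositive ∧ ∀ u : E,
      Integrable (fun s ↦ levyExponent β S ρ (inner ℝ (f s) u)) m ∧
      ∫ s, levyExponent β S ρ (inner ℝ (f s) u) ∂m = levyExponent b T
        (((m.prod ρ).map fun p : α × ℝ ↦ p.2 • f p.1).restrict {0}ᶜ) u := by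
  have hS_one : 0 ≤ S 1 := by simpa using hS.inner_nonneg_left 1
  refine ⟨β • (∫ s, f s ∂m) + ∫ p, truncationDifference p.2 (f p.1) ∂(m.prod ρ),
    S 1 • secondMomentOperator m f,
    (isPositive_secondMomentOperator hf_sq).smul_of_nonneg hS_one, fun u ↦ ?_⟩
  have hdrift : Integrable (fun s ↦ ((inner ℝ β (inner ℝ (f s) u) : ℝ) : ℂ) * Complex.I) m :=
    ((hf_int.inner_const u).const_inner β).ofReal.mul_const _
  have hgauss : Integrable
      (fun s ↦ ((inner ℝ (S (inner ℝ (f s) u)) (inner ℝ (f s) u) : ℝ) : ℂ) / 2) m := by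
    simp_rw [inner_map_self_eq_mul_sq]
    exact ((hf_sq.inner_const u).integrable_sq.const_mul (S 1)).ofReal.div_const 2
  have hkernel := integrable_levyKernel_inner hf hjump htrunc u
  have hdrift_integral : ∫ s, ((inner ℝ β (inner ℝ (f s) u) : ℝ) : ℂ) * Complex.I ∂m
      = (inner ℝ (β • ∫ s, f s ∂m) u : ℝ) * Complex.I := by
    rw [integral_mul_const, integral_complex_ofReal, integral_inner (hf_int.inner_const u),
      integral_inner_const hf_int, real_inner_smul_left, RCLike.inner_apply, conj_trivial,
      mul_comm β]
  have hgauss_integral :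
      ∫ s, ((inner ℝ (S (inner ℝ (f s) u)) (inner ℝ (f s) u) : ℝ) : ℂ) / 2 ∂m
        = ((inner ℝ ((S 1 • secondMomentOperator m f) u) u : ℝ) : ℂ) / 2 := by
    simp_rw [inner_map_self_eq_mul_sq, sq]
    rw [integral_div, integral_complex_ofReal, integral_const_mul, smul_apply,
      real_inner_smul_left, inner_secondMomentOperator hf_sq]
  refine ⟨(hdrift.sub hgauss).add hkernel.integral_prod_left, ?_⟩
  unfold levyExponent
  rw [integral_add (by exact hdrift.sub hgauss) (by exact hkernel.integral_prod_left),
    integral_sub hdrift hgauss, integral_integral hkernel, hdrift_integral, hgauss_integral,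
    integral_levyKernel_inner hf hjump htrunc, setIntegral_compl_zero_levyKernel, inner_add_left]
  push_cast
  ring

end IntegratedExponent

section ExponentialKernel

variable {E : Type*} [NormedAddCommGroup E] [InnerProductSpace ℝ E]

lemma norm_truncationDifference_le (x : ℝ) (y : E) :
    ‖truncationDifference x y‖ ≤ ‖y‖ ^ 2 * min 1 (‖x‖ ^ 2)
      + if 1 < ‖x‖ ∧ ‖x • y‖ ≤ 1 then ‖x • y‖ else 0 := by
  have hnonneg : 0 ≤ ‖y‖ ^ 2 * min 1 (‖x‖ ^ 2) := by positivity
  unfold truncationDifference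
  rcases le_or_gt ‖x‖ 1 with hx | hx
  · have hlarge : ¬(1 < ‖x‖ ∧ ‖x • y‖ ≤ 1) := fun h ↦ h.1.not_ge hx
    rw [if_pos hx, if_neg hlarge, add_zero]
    split_ifs with hxy
    · simpa using hnonneg
    · rw [min_eq_right (pow_le_one₀ (norm_nonneg x) hx), ← mul_pow, mul_comm, ← norm_smul,
        zero_sub, norm_neg]
      exact le_self_pow₀ (not_le.1 hxy).le two_ne_zero
  · rw [if_neg hx.not_ge, sub_zero]
    split_ifs <;> grind [norm_zero]

lemma integrable_indicator_Ici_exp_neg_mul {c : ℝ} (hc : 0 < c) (a C : ℝ) :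
    Integrable ((Set.Ici a).indicator fun s ↦ C * Real.exp (-c * s)) := by
  rw [integrable_indicator_iff measurableSet_Ici, integrableOn_Ici_iff_integrableOn_Ioi]
  exact (integrableOn_exp_mul_Ioi (neg_lt_zero.2 hc) a).const_mul C

lemma integrable_norm_pow_of_norm_le_exp_neg {E : Type*} [NormedAddCommGroup E]
    [MeasurableSpace E] [BorelSpace E] {f : ℝ → E} {a C : ℝ} (hf : Measurable f)
    (hupper : ∀ s, ‖f s‖ ≤ (Set.Ici a).indicator (fun s ↦ C * Real.exp (-s)) s) {n : ℕ}
    (hn : n ≠ 0) : Integrable fun s ↦ ‖f s‖ ^ n := by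
  refine (integrable_indicator_Ici_exp_neg_mul (Nat.cast_pos.2 hn.pos) a (C ^ n)).mono'
    (Measurable.aestronglyMeasurable (by fun_prop)) (Eventually.of_forall fun s ↦ ?_)
  rw [norm_pow, norm_norm]
  refine (pow_le_pow_left₀ (norm_nonneg _) (hupper s) n).trans_eq ?_
  by_cases hs : s ∈ Set.Ici a
  · rw [Set.indicator_of_mem hs, Set.indicator_of_mem hs, mul_pow, ← Real.exp_nat_mul]
    ring_nf
  · rw [Set.indicator_of_notMem hs, Set.indicator_of_notMem hs, zero_pow hn]

lemma integral_indicator_Ici_log_mul_exp_neg {c : ℝ} (hc : 0 < c) :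
    ∫ s, (Set.Ici (Real.log c)).indicator (fun s ↦ c * Real.exp (-s)) s = 1 := by
  rw [integral_indicator measurableSet_Ici, integral_Ici_eq_integral_Ioi, integral_const_mul,
    integral_exp_neg_Ioi, Real.exp_neg, Real.exp_log hc, mul_inv_cancel₀ hc.ne']

lemma integrable_indicator_log_norm_le {ρ : Measure ℝ} [SFinite ρ] {w : ℝ → ℝ}
    (hw : Integrable w ρ) :
    Integrable ({p : ℝ × ℝ | Real.log ‖p.2‖ ≤ p.1}.indicator
      fun p ↦ ‖p.2‖ * Real.exp (-p.1) * w p.2) (volume.prod ρ) := by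
  have hset : MeasurableSet {p : ℝ × ℝ | Real.log ‖p.2‖ ≤ p.1} :=
    measurableSet_le (by fun_prop) (by fun_prop)
  have hsection (x s : ℝ) : {p : ℝ × ℝ | Real.log ‖p.2‖ ≤ p.1}.indicator
      (fun p ↦ ‖p.2‖ * Real.exp (-p.1) * w p.2) (s, x)
      = (Set.Ici (Real.log ‖x‖)).indicator (fun s ↦ ‖x‖ * Real.exp (-s)) s * w x := by
    by_cases Real.log ‖x‖ ≤ s <;> simp [Set.indicator]
  have hmeas : AEStronglyMeasurable ({p : ℝ × ℝ | Real.log ‖p.2‖ ≤ p.1}.indicator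
      fun p ↦ ‖p.2‖ * Real.exp (-p.1) * w p.2) (volume.prod ρ) :=
    (AEStronglyMeasurable.mul (Measurable.aestronglyMeasurable (by fun_prop))
      hw.1.comp_snd).indicator hset
  refine (integrable_prod_iff' hmeas).2 ⟨Eventually.of_forall fun x ↦ ?_, ?_⟩
  · simp_rw [hsection]
    simpa using (integrable_indicator_Ici_exp_neg_mul one_pos (Real.log ‖x‖) ‖x‖).mul_const (w x)
  · refine hw.norm.mono' hmeas.norm.prod_swap.integral_prod_right' (Eventually.of_forall fun x ↦ ?_)
    have hnonneg (s : ℝ) :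
        0 ≤ (Set.Ici (Real.log ‖x‖)).indicator (fun s ↦ ‖x‖ * Real.exp (-s)) s :=
      Set.indicator_nonneg (fun _ _ ↦ by positivity) s
    simp_rw [hsection, norm_mul, Real.norm_of_nonneg (hnonneg _), integral_mul_const]
    rcases eq_or_ne x 0 with rfl | hx
    · simp
    · rw [integral_indicator_Ici_log_mul_exp_neg (norm_pos_iff.2 hx), one_mul, norm_norm]

variable [MeasurableSpace E] [BorelSpace E] [SecondCountableTopology E] {f : ℝ → E} {a C : ℝ}

lemma measurable_truncationDifference {α : Type*} [MeasurableSpace α] {x : α → ℝ} {y : α → E}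
    (hx : Measurable x) (hy : Measurable y) :
    Measurable fun a ↦ truncationDifference (x a) (y a) := by
  unfold truncationDifference
  refine (Measurable.ite ?_ (hx.smul hy) measurable_const).sub
    (Measurable.ite ?_ (hx.smul hy) measurable_const)
  · exact measurableSet_le (hx.smul hy).norm measurable_const
  · exact measurableSet_le hx.norm measurable_const

lemma integrable_truncationDifference {ρ : Measure ℝ} [SFinite ρ]
    (hρ : Integrable (fun x ↦ min 1 (‖x‖ ^ 2)) ρ) (hf : Measurable f) (hC : 0 ≤ C)
    (hupper : ∀ s, ‖f s‖ ≤ (Set.Ici a).indicator (fun s ↦ C * Real.exp (-s)) s)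
    (hlower : ∀ s, f s ≠ 0 → Real.exp (-s) ≤ ‖f s‖) :
    Integrable (fun p : ℝ × ℝ ↦ truncationDifference p.2 (f p.1)) (volume.prod ρ) := by
  have hsmall := (integrable_norm_pow_of_norm_le_exp_neg hf hupper two_ne_zero).mul_prod hρ
  have hlarge := (integrable_indicator_log_norm_le hρ).const_mul C
  refine (hsmall.add hlarge).mono' (measurable_truncationDifference measurable_snd
    (hf.comp measurable_fst)).aestronglyMeasurable (Eventually.of_forall fun ⟨s, x⟩ ↦ ?_)
  refine (norm_truncationDifference_le x (f s)).trans (add_le_add_right ?_ _)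
  beta_reduce
  have hnonneg : 0 ≤ {p : ℝ × ℝ | Real.log ‖p.2‖ ≤ p.1}.indicator
      (fun p ↦ ‖p.2‖ * Real.exp (-p.1) * min 1 (‖p.2‖ ^ 2)) (s, x) :=
    Set.indicator_nonneg (fun _ _ ↦ by positivity) _
  split_ifs with hjump
  swap
  · exact mul_nonneg hC hnonneg
  rcases eq_or_ne (f s) 0 with hfs | hfs
  · rw [hfs, smul_zero, norm_zero]
    exact mul_nonneg hC hnonneg
  obtain ⟨hx, hxf⟩ := hjump
  rw [norm_smul] at hxf
  have hlog : Real.log ‖x‖ ≤ s := by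
    rw [Real.log_le_iff_le_exp (one_pos.trans hx), ← div_le_one (Real.exp_pos s), div_eq_mul_inv,
      ← Real.exp_neg]
    exact (mul_le_mul_of_nonneg_left (hlower s hfs) (norm_nonneg x)).trans hxf
  have hfC : ‖f s‖ ≤ C * Real.exp (-s) :=
    (hupper s).trans (Set.indicator_le_self' (fun _ _ ↦ by positivity) s)
  rw [Set.indicator_of_mem (show (s, x) ∈ {p : ℝ × ℝ | Real.log ‖p.2‖ ≤ p.1} from hlog),
    min_eq_left (one_le_pow₀ hx.le), mul_one, norm_smul, mul_left_comm]
  exact mul_le_mul_of_nonneg_left hfC (norm_nonneg x)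

end ExponentialKernel

section ImproperPathIntegral

lemma charFun_map_eq_charFun_map_inner {Ω E : Type*} [MeasurableSpace Ω] {P : Measure Ω}
    [NormedAddCommGroup E] [InnerProductSpace ℝ E] [MeasurableSpace E] [BorelSpace E]
    [SecondCountableTopology E] {V : Ω → E} (hV : AEMeasurable V P) (u : E) :
    charFun (P.map V) u = charFun (P.map fun ω ↦ inner ℝ (V ω) u) 1 := by
  rw [charFun_apply, charFun_apply, integral_map hV (by fun_prop),
    integral_map (by fun_prop) (by fun_prop)]
  simp

variable {Ω : Type*} [MeasurableSpace Ω] {P : Measure Ω} [IsProbabilityMeasure P]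
  {Y : ℝ → Ω → ℝ}

theorem IsTwoSidedLevyProcess.charFun_sum_of_ae_tendsto_pathIntegral
    (hY : IsTwoSidedLevyProcess P Y) {ψ : ℝ → ℂ} (hψ : IsCharExponent (P.map (Y 1)) ψ)
    {ι : Type*} (I : Finset ι) {g : ι → ℝ → ℝ} (hg : ∀ j ∈ I, ContDiff ℝ 1 (g j)) {a : ι → ℝ}
    {Z : ι → Ω → ℝ} (hZ : ∀ j ∈ I, ∀ᵐ ω ∂P, Tendsto
      (fun b ↦ pathIntegral (g j) (fun s ↦ Y s ω) (a j) b) atTop (𝓝 (Z j ω)))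
    (hint : Integrable fun s ↦ ψ (∑ j ∈ I, (Set.Ici (a j)).indicator (g j) s)) :
    charFun (P.map fun ω ↦ ∑ j ∈ I, Z j ω) 1
      = Complex.exp (∫ s, ψ (∑ j ∈ I, (Set.Ici (a j)).indicator (g j) s)) := by
  obtain ⟨M, hM⟩ : ∃ M, ∀ j ∈ I, a j ≤ M := by
    obtain ⟨M, hM⟩ := (I.finite_toSet.image a).bddAbove
    exact ⟨M, fun j hj ↦ hM (Set.mem_image_of_mem a hj)⟩
  have hle (m : ℕ) : ∀ j ∈ I, a j ≤ M + m := fun j hj ↦ (hM j hj).trans (by simp)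
  have hbound : Tendsto (fun m : ℕ ↦ M + (m : ℝ)) atTop atTop :=
    tendsto_atTop_add_const_left _ M tendsto_natCast_atTop_atTop
  have hcharFun : Tendsto (fun m : ℕ ↦ charFun (P.map fun ω ↦
      ∑ j ∈ I, pathIntegral (g j) (fun s ↦ Y s ω) (a j) (M + m)) 1) atTop
      (𝓝 (charFun (P.map fun ω ↦ ∑ j ∈ I, Z j ω) 1)) := by
    refine tendsto_charFun_map_of_ae_tendsto (fun m ↦ Finset.aemeasurable_fun_sum _ fun j hj ↦
      hY.aemeasurable_pathIntegral (hg j hj) (hle m j hj)) ?_ 1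
    filter_upwards [(ae_ball_iff I.countable_toSet).2 hZ] with ω hω
    exact tendsto_finsetSum _ fun j hj ↦ (hω j hj).comp hbound
  have htruncate (m : ℕ) (s : ℝ) :
      ψ (∑ j ∈ I, (Set.Ico (a j) (M + m)).indicator (g j) s) = (Set.Iio (M + (m : ℝ))).indicator
        (fun s ↦ ψ (∑ j ∈ I, (Set.Ici (a j)).indicator (g j) s)) s := by
    by_cases hs : s < M + m <;> simp [Set.indicator, hs, hψ.map_zero]
  refine tendsto_nhds_unique hcharFun ?_
  simp_rw [hY.charFun_sum_pathIntegral hψ I hg (hle _), htruncate]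
  refine (Complex.continuous_exp.tendsto _).comp (tendsto_integral_of_dominated_convergence _
    (fun m ↦ hint.aestronglyMeasurable.indicator measurableSet_Iio) hint.norm
    (fun m ↦ Eventually.of_forall fun s ↦ norm_indicator_le_norm_self _ _)
    (Eventually.of_forall fun s ↦ tendsto_const_nhds.congr' ?_))
  filter_upwards [hbound.eventually_gt_atTop s] with m hm
  rw [Set.indicator_of_mem (Set.mem_Iio.2 hm)]

end ImproperPathIntegral

section SatoKernel

/-- The integrand of `X_t = ∫_{log (t^{-H})}^∞ e^{-s} dY_s`. It is set to zero at `t = 0`, where the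
lower limit `log (0 ^ (-H))` has the junk value `0` instead of `∞`. -/
noncomputable def satoIntegrand (t : ℝ≥0) (s : ℝ) : ℝ := if t = 0 then 0 else Real.exp (-s)

lemma satoIntegrand_zero : satoIntegrand 0 = fun _ ↦ 0 := by
  simp [funext_iff, satoIntegrand]

lemma satoIntegrand_of_ne_zero {t : ℝ≥0} (ht : t ≠ 0) :
    satoIntegrand t = fun s ↦ Real.exp (-s) := by
  simp [funext_iff, satoIntegrand, ht]

lemma contDiff_satoIntegrand (t : ℝ≥0) : ContDiff ℝ 1 (satoIntegrand t) := by
  unfold satoIntegrand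
  split_ifs <;> fun_prop

variable {H : ℝ}

lemma exp_neg_div_le_iff_log_rpow_le (hH : 0 < H) {t : ℝ} (ht : 0 < t) (s : ℝ) :
    Real.exp (-s / H) ≤ t ↔ Real.log (t ^ (-H)) ≤ s := by
  rw [← Real.le_log_iff_exp_le ht, Real.log_rpow ht, div_le_iff₀ hH, neg_le, neg_mul, mul_comm]

lemma jumpPath_eq_smul (H s x : ℝ) : jumpPath H s x = x • jumpPath H s 1 := by
  ext t
  simp [jumpPath, mul_assoc]

lemma jumpPath_one_apply (hH : 0 < H) (s : ℝ) (t : ℝ≥0) :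
    jumpPath H s 1 t = (Set.Ici (Real.log ((t : ℝ) ^ (-H)))).indicator (satoIntegrand t) s := by
  rcases eq_or_ne t 0 with rfl | ht
  · simp [jumpPath, satoIntegrand_zero, Set.indicator, Real.exp_pos]
  · simp [jumpPath, satoIntegrand_of_ne_zero ht, Set.indicator,
      exp_neg_div_le_iff_log_rpow_le hH (NNReal.coe_pos.2 ht.pos)]

lemma jumpPath_one_eq_zero_or (H s : ℝ) (t : ℝ≥0) :
    jumpPath H s 1 t = 0 ∨ jumpPath H s 1 t = Real.exp (-s) := by
  by_cases ht : Real.exp (-s / H) ≤ t <;> simp [jumpPath, Set.indicator, ht]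

lemma measurable_jumpPath_one (hH : 0 < H) : Measurable fun s ↦ jumpPath H s 1 := by
  refine measurable_pi_lambda _ fun t ↦ ?_
  simp_rw [jumpPath_one_apply hH]
  exact (contDiff_satoIntegrand t).continuous.measurable.indicator measurableSet_Ici

lemma measurable_jumpPath (hH : 0 < H) : Measurable fun p : ℝ × ℝ ↦ jumpPath H p.1 p.2 := by
  have hone := measurable_jumpPath_one hH
  simp_rw [fun p : ℝ × ℝ ↦ jumpPath_eq_smul H p.1 p.2]
  refine measurable_pi_lambda _ fun t ↦ ?_
  simp only [Pi.smul_apply, smul_eq_mul]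
  fun_prop

/-- The vector `(f_t(s))_{t ∈ I}` of the values `f_t(s) = e^{-s} 1_{[e^{-s/H}, ∞)}(t)` at finitely
many times. -/
noncomputable def satoKernel (H : ℝ) (I : Finset ℝ≥0) (s : ℝ) : EuclideanSpace ℝ I :=
  euclideanRestrict I (jumpPath H s 1)

variable (I : Finset ℝ≥0)

lemma measurable_satoKernel (hH : 0 < H) : Measurable (satoKernel H I) :=
  (measurable_euclideanRestrict I).comp (measurable_jumpPath_one hH)

lemma euclideanRestrict_jumpPath (H s x : ℝ) :
    euclideanRestrict I (jumpPath H s x) = x • satoKernel H I s := by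
  ext t
  simp [satoKernel, jumpPath_eq_smul H s x]

lemma exp_neg_le_norm_satoKernel (H s : ℝ) (hne : satoKernel H I s ≠ 0) :
    Real.exp (-s) ≤ ‖satoKernel H I s‖ := by
  obtain ⟨t, ht⟩ : ∃ t : I, jumpPath H s 1 t ≠ 0 := by
    by_contra! hzero
    exact hne (by ext t; simpa [satoKernel] using hzero t)
  calc Real.exp (-s) = jumpPath H s 1 t := ((jumpPath_one_eq_zero_or H s t).resolve_left ht).symm
    _ ≤ ‖satoKernel H I s‖ :=
        (le_abs_self _).trans (abs_apply_le_norm_euclideanRestrict t.2 (jumpPath H s 1))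

lemma norm_satoKernel_le (hH : 0 < H) {a : ℝ} (ha : ∀ t ∈ I, a ≤ Real.log ((t : ℝ) ^ (-H)))
    (s : ℝ) : ‖satoKernel H I s‖ ≤ (Set.Ici a).indicator (fun s ↦ I.card * Real.exp (-s)) s := by
  by_cases hs : s ∈ Set.Ici a
  · rw [Set.indicator_of_mem hs]
    refine abs_le_of_sq_le_sq' ?_ (by positivity) |>.2
    calc ‖satoKernel H I s‖ ^ 2 = ∑ t : I, jumpPath H s 1 t ^ 2 := by
          simp [EuclideanSpace.norm_sq_eq, satoKernel]
      _ ≤ ∑ _t : I, Real.exp (-s) ^ 2 := Finset.sum_le_sum fun t _ ↦ by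
          rcases jumpPath_one_eq_zero_or H s t with h | h <;> rw [h]
          simp [sq_nonneg]
      _ = I.card * Real.exp (-s) ^ 2 := by simp
      _ ≤ (I.card * Real.exp (-s)) ^ 2 := by
          rw [mul_pow]
          gcongr
          exact_mod_cast Nat.le_self_pow two_ne_zero I.card
  · have hzero : satoKernel H I s = 0 := by
      ext t
      have hst : s ∉ Set.Ici (Real.log ((t : ℝ) ^ (-H))) := fun h ↦ hs ((ha t t.2).trans h)
      simp only [satoKernel, euclideanRestrict_apply, PiLp.zero_apply, jumpPath_one_apply hH,
        Set.indicator_of_notMem hst]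
    simp [hzero, hs]

end SatoKernel

section MinOne

lemma min_one_sum_le {ι : Type*} (I : Finset ι) {f : ι → ℝ} (hf : ∀ i ∈ I, 0 ≤ f i) :
    min 1 (∑ i ∈ I, f i) ≤ ∑ i ∈ I, min 1 (f i) := by
  refine Finset.le_sum_of_subadditive_on_pred (min 1) (0 ≤ ·) (by simp) (fun x y hx hy ↦ ?_)
    (fun x y hx hy ↦ add_nonneg hx hy) f hf
  grind

lemma integrable_min_one_norm_sq_of_apply {α ι : Type*} [MeasurableSpace α] [Fintype ι]
    {m : Measure α} {f : α → EuclideanSpace ℝ ι} (hf : Measurable f)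
    (hcoord : ∀ i, Integrable (fun a ↦ min 1 (f a i ^ 2)) m) :
    Integrable (fun a ↦ min 1 (‖f a‖ ^ 2)) m := by
  refine (integrable_finsetSum Finset.univ fun i _ ↦ hcoord i).mono'
    (Measurable.aestronglyMeasurable (by fun_prop)) (Eventually.of_forall fun a ↦ ?_)
  rw [Real.norm_of_nonneg (by positivity), EuclideanSpace.real_norm_sq_eq]
  exact min_one_sum_le _ fun i _ ↦ sq_nonneg _

end MinOne

section SatoProcess

variable {Ω : Type*} [MeasurableSpace Ω] {P : Measure Ω} [IsProbabilityMeasure P]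
  {Y : ℝ → Ω → ℝ} {H : ℝ} {X : ℝ≥0 → Ω → ℝ} {ρ : Measure ℝ}

lemma ae_tendsto_pathIntegral_satoProcess (hY : IsTwoSidedLevyProcess P Y)
    (hlog : Integrable (fun ω ↦ Real.posLog |Y 1 ω|) P)
    (hX : ∀ t, X t =ᵐ[P] satoProcess Y H t) {t : ℝ≥0} (ht : 0 < t) :
    ∀ᵐ ω ∂P, Tendsto (fun b : ℝ ↦ pathIntegral (fun s ↦ Real.exp (-s)) (fun s ↦ Y s ω)
      (Real.log ((t : ℝ) ^ (-H))) b) atTop (𝓝 (X t ω)) := by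
  filter_upwards [hY.ae_isCadlag, hY.ae_isBigO_exp hlog one_half_pos, hX t]
    with ω hcadlag hgrowth hXt
  obtain ⟨l, hl⟩ := exists_tendsto_pathIntegral_exp_neg hcadlag one_half_lt_one hgrowth
    (Real.log ((t : ℝ) ^ (-H)))
  rw [hXt, satoProcess, if_neg ht.ne', hl.limUnder_eq]
  exact hl

lemma ae_tendsto_pathIntegral_satoIntegrand (hY : IsTwoSidedLevyProcess P Y)
    (hlog : Integrable (fun ω ↦ Real.posLog |Y 1 ω|) P)
    (hX : ∀ t, X t =ᵐ[P] satoProcess Y H t) (t : ℝ≥0) :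
    ∀ᵐ ω ∂P, Tendsto (fun b : ℝ ↦ pathIntegral (satoIntegrand t) (fun s ↦ Y s ω)
      (Real.log ((t : ℝ) ^ (-H))) b) atTop (𝓝 (X t ω)) := by
  rcases eq_or_ne t 0 with rfl | ht
  · filter_upwards [hX 0] with ω hω
    simp [hω, satoProcess, satoIntegrand_zero, pathIntegral]
  · simpa only [satoIntegrand_of_ne_zero ht] using
      ae_tendsto_pathIntegral_satoProcess hY hlog hX ht.pos

lemma aemeasurable_of_eq_satoProcess (hY : IsTwoSidedLevyProcess P Y)
    (hlog : Integrable (fun ω ↦ Real.posLog |Y 1 ω|) P)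
    (hX : ∀ t, X t =ᵐ[P] satoProcess Y H t) (t : ℝ≥0) : AEMeasurable (X t) P :=
  hY.aemeasurable_of_ae_tendsto_pathIntegral (contDiff_satoIntegrand t)
    (ae_tendsto_pathIntegral_satoIntegrand hY hlog hX t)

lemma charFun_map_euclideanRestrict_satoProcess (hY : IsTwoSidedLevyProcess P Y)
    (hlog : Integrable (fun ω ↦ Real.posLog |Y 1 ω|) P) (hH : 0 < H)
    (hX : ∀ t, X t =ᵐ[P] satoProcess Y H t) {ψ : ℝ → ℂ} (hψ : IsCharExponent (P.map (Y 1)) ψ)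
    (I : Finset ℝ≥0) (u : EuclideanSpace ℝ I)
    (hint : Integrable fun s ↦ ψ (inner ℝ (satoKernel H I s) u)) :
    charFun (P.map fun ω ↦ euclideanRestrict I fun t ↦ X t ω) u
      = Complex.exp (∫ s, ψ (inner ℝ (satoKernel H I s) u)) := by
  have hV : AEMeasurable (fun ω ↦ euclideanRestrict I fun t ↦ X t ω) P :=
    (WithLp.measurable_toLp 2 _).comp_aemeasurable
      (aemeasurable_pi_iff.2 fun t ↦ aemeasurable_of_eq_satoProcess hY hlog hX t)
  have hkernel (s : ℝ) : inner ℝ (satoKernel H I s) u = ∑ t : I,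
      (Set.Ici (Real.log ((t : ℝ) ^ (-H)))).indicator (fun s ↦ u t * satoIntegrand t s) s := by
    simp [PiLp.inner_apply, satoKernel, jumpPath_one_apply hH, Set.indicator_const_mul]
  have hlimit (t : I) : ∀ᵐ ω ∂P, Tendsto (fun b : ℝ ↦ pathIntegral
      (fun s ↦ u t * satoIntegrand t s) (fun s ↦ Y s ω) (Real.log ((t : ℝ) ^ (-H))) b) atTop
      (𝓝 (u t * X t ω)) := by
    filter_upwards [ae_tendsto_pathIntegral_satoIntegrand hY hlog hX t] with ω hω
    simpa only [pathIntegral_const_mul] using hω.const_mul (u t)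
  have hinner (ω : Ω) : inner ℝ (euclideanRestrict I fun t ↦ X t ω) u = ∑ t : I, u t * X t ω := by
    simp [PiLp.inner_apply]
  simp_rw [hkernel] at hint ⊢
  simp_rw [charFun_map_eq_charFun_map_inner hV, hinner]
  exact hY.charFun_sum_of_ae_tendsto_pathIntegral hψ Finset.univ
    (g := fun (t : I) s ↦ u t * satoIntegrand t s)
    (fun t _ ↦ contDiff_const.mul (contDiff_satoIntegrand t)) (fun t _ ↦ hlimit t) hint

lemma integrable_min_one_norm_sq_smul_satoKernel (hY : IsTwoSidedLevyProcess P Y)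
    (hlog : Integrable (fun ω ↦ Real.posLog |Y 1 ω|) P) (hH : 0 < H)
    (hX : ∀ t, X t =ᵐ[P] satoProcess Y H t) (hρ : IsLevyMeasure (P.map (Y 1)) ρ)
    (I : Finset ℝ≥0) :
    Integrable (fun p : ℝ × ℝ ↦ min 1 (‖p.2 • satoKernel H I p.1‖ ^ 2)) (volume.prod ρ) := by
  obtain ⟨β, S, hS, hψ⟩ := hρ.exists_isCharExponent_levyExponent
  have := hρ.sigmaFinite
  have hkernel := measurable_satoKernel I hH
  refine integrable_min_one_norm_sq_of_apply (by fun_prop) fun t ↦ ?_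
  simpa [satoKernel, jumpPath_one_apply hH] using hY.integrable_min_one_sq_mul_indicator_Ici
    hρ.integrable_min_one_norm_sq hS hψ (contDiff_satoIntegrand t)
    (ae_tendsto_pathIntegral_satoIntegrand hY hlog hX t)

lemma exists_integral_levyExponent_inner_satoKernel_eq [SFinite ρ] (hH : 0 < H)
    (hρ : Integrable (fun x ↦ min 1 (‖x‖ ^ 2)) ρ) (I : Finset ℝ≥0)
    (hjump : Integrable (fun p : ℝ × ℝ ↦ min 1 (‖p.2 • satoKernel H I p.1‖ ^ 2)) (volume.prod ρ))
    (β : ℝ) {S : ℝ →L[ℝ] ℝ} (hS : S.IsPositive) :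
    ∃ (b : EuclideanSpace ℝ I) (T : EuclideanSpace ℝ I →L[ℝ] EuclideanSpace ℝ I), T.IsPositive ∧
      ∀ u, Integrable (fun s ↦ levyExponent β S ρ (inner ℝ (satoKernel H I s) u)) ∧
        ∫ s, levyExponent β S ρ (inner ℝ (satoKernel H I s) u) = levyExponent b T
          (((volume.prod ρ).map fun p : ℝ × ℝ ↦ p.2 • satoKernel H I p.1).restrict {0}ᶜ) u := by
  obtain ⟨a, ha⟩ : ∃ a : ℝ, ∀ t ∈ I, a ≤ Real.log ((t : ℝ) ^ (-H)) := by
    obtain ⟨a, ha⟩ := (I.finite_toSet.image fun t : ℝ≥0 ↦ Real.log ((t : ℝ) ^ (-H))).bddBelow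
    exact ⟨a, fun t ht ↦ ha ⟨t, ht, rfl⟩⟩
  have hkernel := measurable_satoKernel I hH
  have hupper := norm_satoKernel_le I hH ha
  have hint : Integrable (satoKernel H I) := (integrable_norm_iff hkernel.aestronglyMeasurable).1
    (by simpa using integrable_norm_pow_of_norm_le_exp_neg hkernel hupper one_ne_zero)
  have hsq : MemLp (satoKernel H I) 2 :=
    (memLp_two_iff_integrable_sq_norm hkernel.aestronglyMeasurable).2
      (integrable_norm_pow_of_norm_le_exp_neg hkernel hupper two_ne_zero)
  exact exists_integral_levyExponent_inner_eq β hS hkernel hint hsq hjump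
    (integrable_truncationDifference hρ hkernel I.card.cast_nonneg hupper
      (exp_neg_le_norm_satoKernel I H))

theorem isLevyMeasure_map_smul_satoKernel (hY : IsTwoSidedLevyProcess P Y)
    (hlog : Integrable (fun ω ↦ Real.posLog |Y 1 ω|) P) (hH : 0 < H)
    (hX : ∀ t, X t =ᵐ[P] satoProcess Y H t) (hρ : IsLevyMeasure (P.map (Y 1)) ρ)
    (I : Finset ℝ≥0) :
    IsLevyMeasure (P.map fun ω ↦ euclideanRestrict I fun t ↦ X t ω)
      (((volume.prod ρ).map fun p : ℝ × ℝ ↦ p.2 • satoKernel H I p.1).restrict {0}ᶜ) := by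
  obtain ⟨β, S, hS, hψ⟩ := hρ.exists_isCharExponent_levyExponent
  have := hρ.sigmaFinite
  have hkernel := measurable_satoKernel I hH
  have hjump := integrable_min_one_norm_sq_smul_satoKernel hY hlog hH hX hρ I
  obtain ⟨b, T, hT, hexponent⟩ := exists_integral_levyExponent_inner_satoKernel_eq hH
    hρ.integrable_min_one_norm_sq I hjump β hS
  refine ⟨by simp [Measure.restrict_apply], ?_, b, T, hT, fun u ↦ ?_⟩
  · refine (setLIntegral_le_lintegral _ _).trans_lt ?_
    rw [lintegral_map (by fun_prop) (by fun_prop),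
      ← hasFiniteIntegral_iff_ofReal (Eventually.of_forall fun _ ↦ by positivity)]
    exact hjump.2
  · rw [charFun_map_euclideanRestrict_satoProcess hY hlog hH hX hψ I u (hexponent u).1,
      (hexponent u).2]
    rfl

end SatoProcess

section InnerRegularity

lemma measurableSet_exists_mem_ne_zero {T : Type*} {J : Set T} (hJ : J.Countable) :
    MeasurableSet {f : T → ℝ | ∃ t ∈ J, f t ≠ 0} := by
  have hunion : {f : T → ℝ | ∃ t ∈ J, f t ≠ 0} = ⋃ t ∈ J, {f | f t ≠ 0} := by
    ext f
    simp
  rw [hunion]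
  exact .biUnion hJ fun t _ ↦ (measurable_pi_apply t) (measurableSet_singleton 0).compl

lemma measure_eq_iSup_subset_diff_zero {T : Type*} {ν : Measure (T → ℝ)} {J : Set T}
    (hJ : J.Countable) (hν : ∀ᵐ f ∂ν, ∃ t ∈ J, f t ≠ 0) {A : Set (T → ℝ)} (hA : MeasurableSet A) :
    ν A = ⨆ (B : Set (T → ℝ)) (_ : MeasurableSet B) (_ : B ⊆ A \ {0}), ν B := by
  refine le_antisymm ?_ (iSup_le fun B ↦ iSup₂_le fun _ hB ↦
    measure_mono (hB.trans Set.sdiff_subset))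
  rw [← measure_inter_conull (mem_ae_iff.1 hν)]
  refine le_iSup_of_le _ (le_iSup₂_of_le (hA.inter (measurableSet_exists_mem_ne_zero hJ)) ?_ le_rfl)
  rintro f ⟨hfA, t, -, hft⟩
  exact ⟨hfA, fun hf ↦ hft (congrFun hf t)⟩

lemma ae_map_jumpPath_exists_natCast_ne_zero {H : ℝ} (hH : 0 < H) {ρ : Measure ℝ} [SFinite ρ]
    (hρ : ∀ᵐ x ∂ρ, x ≠ 0) :
    ∀ᵐ f ∂((volume.prod ρ).map fun p : ℝ × ℝ ↦ jumpPath H p.1 p.2),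
      ∃ t ∈ Set.range ((↑) : ℕ → ℝ≥0), f t ≠ 0 := by
  have hsnd : ∀ᵐ p ∂((volume : Measure ℝ).prod ρ), p.2 ≠ 0 :=
    Measure.quasiMeasurePreserving_snd.ae hρ
  rw [ae_map_iff (measurable_jumpPath hH).aemeasurable
    (measurableSet_exists_mem_ne_zero (Set.countable_range _))]
  filter_upwards [hsnd] with ⟨s, x⟩ hx
  obtain ⟨n, hn⟩ := exists_nat_ge (Real.exp (-s / H))
  exact ⟨n, ⟨n, rfl⟩, by simp [jumpPath, hn, hx]⟩

end InnerRegularity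

theorem isProcessLevyMeasure_map_jumpPath {Ω : Type*} [MeasurableSpace Ω] {P : Measure Ω}
    [IsProbabilityMeasure P] {Y : ℝ → Ω → ℝ} (hY : IsTwoSidedLevyProcess P Y)
    (hlog : Integrable (fun ω ↦ Real.posLog |Y 1 ω|) P) {H : ℝ} (hH : 0 < H)
    {X : ℝ≥0 → Ω → ℝ} (hX : ∀ t, X t =ᵐ[P] satoProcess Y H t) {ρ : Measure ℝ}
    (hρ : IsLevyMeasure (P.map (Y 1)) ρ) :
    IsProcessLevyMeasure P X ((volume.prod ρ).map fun p : ℝ × ℝ ↦ jumpPath H p.1 p.2) := by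
  have := hρ.sigmaFinite
  refine ⟨fun I ↦ ?_, fun A hA ↦ measure_eq_iSup_subset_diff_zero (Set.countable_range _)
    (ae_map_jumpPath_exists_natCast_ne_zero hH hρ.ae_ne_zero) hA⟩
  have hmap : ((volume.prod ρ).map fun p : ℝ × ℝ ↦ jumpPath H p.1 p.2).map (euclideanRestrict I)
      = (volume.prod ρ).map fun p : ℝ × ℝ ↦ p.2 • satoKernel H I p.1 := by
    rw [Measure.map_map (measurable_euclideanRestrict I) (measurable_jumpPath hH)]
    exact congrArg (Measure.map · _) (funext fun p : ℝ × ℝ ↦ euclideanRestrict_jumpPath I H p.1 p.2)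
  have hlevy := isLevyMeasure_map_smul_satoKernel hY hlog hH hX hρ I
  rwa [← hmap] at hlevy

theorem mainTheorem3 {Ω : Type*} [MeasurableSpace Ω] (P : Measure Ω) [IsProbabilityMeasure P]
    (Y : ℝ → Ω → ℝ) (hY : IsTwoSidedLevyProcess P Y)
    (hlog : Integrable (fun ω ↦ Real.posLog |Y 1 ω|) P)
    (H : ℝ) (hH : 0 < H)
    (X : ℝ≥0 → Ω → ℝ) (hX : ∀ t, X t =ᵐ[P] satoProcess Y H t)
    (ρ : Measure ℝ) (hρ : IsLevyMeasure (P.map (Y 1)) ρ) :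
    -- the improper integrals defining `X` converge almost surely
    (∀ t : ℝ≥0, 0 < t → ∀ᵐ ω ∂P, Tendsto
      (fun b : ℝ ↦ pathIntegral (fun s ↦ Real.exp (-s)) (fun s ↦ Y s ω)
        (Real.log ((t : ℝ) ^ (-H))) b) atTop (𝓝 (X t ω))) ∧
    -- `X` has exactly one Lévy measure `ν`, and `ν` is as claimed
    ∃ ν : Measure (ℝ≥0 → ℝ),
      IsProcessLevyMeasure P X ν ∧
      (∀ ν' : Measure (ℝ≥0 → ℝ), IsProcessLevyMeasure P X ν' → ν' = ν) ∧
      (∀ F : (ℝ≥0 → ℝ) → ℝ≥0∞, Measurable F →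
        ∫⁻ f, F f ∂ν = ∫⁻ s : ℝ, ∫⁻ x : ℝ, F (jumpPath H s x) ∂ρ) ∧
      ν = ((volume : Measure ℝ).prod ρ).map (fun p : ℝ × ℝ ↦ jumpPath H p.1 p.2) := by
  have hν := isProcessLevyMeasure_map_jumpPath hY hlog hH hX hρ
  refine ⟨fun t ht ↦ ae_tendsto_pathIntegral_satoProcess hY hlog hX ht, _, hν,
    fun ν' hν' ↦ hν'.unique hν, fun F hF ↦ ?_, rfl⟩
  have := hρ.sigmaFinite
  have hjump := measurable_jumpPath hH
  rw [lintegral_map hF hjump]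
  exact lintegral_prod _ (hF.comp hjump).aemeasurable
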